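/- Let $H$ be a separable (real or complex) Hilbert space and let $A$ be an unbounded positive self-adjoint operator in $H$ with a complete orthonormal system of eigenvectors $v_k$, $Av_k=\lambda_kv_k$, $k\ge 1$, where $0<\lambda_1\le\lambda_2\le\cdots\to+\infty$. Let $0<\rho<1$ and put $$\partial_t^{\rho-1}h(t)=\frac1{\Gamma(1-\rho)}\int_0^t\frac{h(\xi)}{(t-\xi)^{\rho}}\,d\xi,\qquad \partial_t^{\rho}h(t)=\frac{d}{dt}\,\partial_t^{\rho-1}h(t)$$ (Riemann-Liouville fractional integral and derivative). For $\varphi\in H$ and $T>0$, a solution on $(0,T]$ of the forward problem with $f\equiv0$, $$\partial_t^\rho u(t)+Au(t)=0\quad(0<t<T),\qquad \lim_{t\to0+}\partial_t^{\rho-1}u(t)=\varphi,$$ is a function $u\in C((0,T];H)$ for which $\partial_t^\rho u$ and $Au$ exist and belong to $C((0,T);H)$, and which satisfies these two conditions. Then for every $\varphi\in H$ there is a function $u:(0,\infty)\to H$ which, for every $T>0$, is the unique solution on $(0,T]$; it is infinitely differentiable, $u\in C^\infty((0,\infty);H)$. There are constants $C$, depending only on $\rho$, and $C_m$, depending only on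 $\rho$ and $m$, such that for all such $H$, $A$ and all $\varphi\in H$ $$\|u(t)\|\le\frac{C\,t^{\rho-1}}{1+(\lambda_1t^\rho)^2}\,\|\varphi\|,\qquad \|\partial_t^mu(t)\|\le C_m\,t^{\rho-1-m}\,\|\varphi\|\qquad(t>0,\ m\in\mathbb N).$$ -/

import Mathlib

open Set Filter Topology MeasureTheory
open scoped ContDiff

noncomputable section

namespace Subdiffusion

variable {E : Type*} [NormedAddCommGroup E] [NormedSpace ℝ E]

/-- The integrand `(t - ξ)^(-(σ + 1)) h(ξ)`, as a function of `ξ`, of the Riemann-Liouville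
fractional integral of order `σ < 0` at time `t`. -/
def rlIntegrand (σ : ℝ) (h : ℝ → E) (t ξ : ℝ) : E := (t - ξ) ^ (-(σ + 1)) • h ξ

/-- The fractional integral exists at `t` (as a Bochner integral). -/
def RLIntegrable (σ : ℝ) (h : ℝ → E) (t : ℝ) : Prop :=
  IntervalIntegrable (rlIntegrand σ h t) volume 0 t

/-- Riemann-Liouville fractional integral of order `σ < 0`:
`∂_t^σ h(t) = Γ(-σ)⁻¹ ∫_0^t (t - ξ)^(-(σ + 1)) h(ξ) dξ`. -/
def rlIntegral (σ : ℝ) (h : ℝ → E) (t : ℝ) : E :=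
  (Real.Gamma (-σ))⁻¹ • ∫ ξ in (0 : ℝ)..t, rlIntegrand σ h t ξ

/-- Riemann-Liouville fractional derivative of order `0 < ρ < 1`:
`∂_t^ρ h(t) = d/dt ∂_t^(ρ - 1) h(t)`. -/
def rlDeriv (ρ : ℝ) (h : ℝ → E) (t : ℝ) : E := deriv (rlIntegral (ρ - 1) h) t

/-- `u` solves the forward problem `∂_t^ρ u + A u = f` on `(0, T)`, `∂_t^(ρ - 1) u(t) → φ` as
`t → 0+`: the function `u` is continuous on `(0, T]`, `∂_t^ρ u` and `A u` exist and are continuous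
on `(0, T)`, and the two conditions hold. Only the values of `u` on `(0, T]` matter. -/
structure IsForwardSolution {𝕜 H : Type*} [RCLike 𝕜] [NormedAddCommGroup H]
    [InnerProductSpace 𝕜 H] [NormedSpace ℝ H]
    (A : H →ₗ.[𝕜] H) (ρ T : ℝ) (f : ℝ → H) (φ : H) (u : ℝ → H) : Prop where
  continuousOn : ContinuousOn u (Ioc 0 T)
  rlIntegrable : ∀ t ∈ Ioo 0 T, RLIntegrable (ρ - 1) u t
  differentiableAt : ∀ t ∈ Ioo 0 T, DifferentiableAt ℝ (rlIntegral (ρ - 1) u) t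
  continuousOn_rlDeriv : ContinuousOn (rlDeriv ρ u) (Ioo 0 T)
  mem_domain : ∀ t : Ioo 0 T, u t ∈ A.domain
  continuous_apply : Continuous fun t : Ioo 0 T => A ⟨u t, mem_domain t⟩
  equation : ∀ t : Ioo 0 T, rlDeriv ρ u t + A ⟨u t, mem_domain t⟩ = f t
  initial : Tendsto (rlIntegral (ρ - 1) u) (𝓝[>] 0) (𝓝 φ)

/-- `A` is a self-adjoint (densely defined, in general unbounded) operator in `H`, the complete
orthonormal system `v` consists of eigenvectors of `A`, and the corresponding eigenvalues satisfy
`0 < lam 0 ≤ lam 1 ≤ ⋯ → +∞` (so `A` is positive and unbounded). -/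
structure IsPositiveDiscrete {𝕜 H : Type*} [RCLike 𝕜] [NormedAddCommGroup H]
    [InnerProductSpace 𝕜 H] [CompleteSpace H]
    (A : H →ₗ.[𝕜] H) (v : HilbertBasis ℕ 𝕜 H) (lam : ℕ → ℝ) : Prop where
  isSelfAdjoint : IsSelfAdjoint A
  mem_domain : ∀ k, v k ∈ A.domain
  apply_eq : ∀ k, A ⟨v k, mem_domain k⟩ = (lam k : 𝕜) • v k
  pos : 0 < lam 0
  monotone : Monotone lam
  tendsto : Tendsto lam atTop atTop

end Subdiffusion

end

/-! In the eigenbasis the problem splits into scalar equations, solved by `t ^ (ρ - 1) E_{ρ,ρ}(-λ t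
^ ρ)` times the coordinate of `φ`. No power series is used: this factor is introduced as the Laplace
transform of a nonnegative density `K_λ(r)`, `mlDensity`. The bounds `K_λ ≤ c r ^ (-ρ)`, `λ K_λ ≤ c`
and `λ K_λ / r ≤ (c / λ₁) r ^ (ρ - 1)` are uniform over the spectrum (`λ₁` is `lam 0`), so `K_λ`, `λ
K_λ`, `λ K_λ / r` define diagonal operators whose vector-valued Laplace transforms converge for
every `φ`. Smoothness and all derivative bounds then follow from `∫ e ^ (-rt) r ^ a dr = Γ(a + 1) t
^ (-(a + 1))`. The decay estimate comes from `K_λ ≤ c r ^ ρ / (r ^ (2ρ) + λ₁ ^ 2)`.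

The equation rests on `rlIntegral_laplace_mlDensity`: the fractional integral of the transform of
`K_λ` is the transform of `λ K_λ / r`. Differentiating the latter in `t` cancels `1 / r` and gives
`-λ` times the transform of `K_λ`. Both sides of the identity have Laplace transform `s ^ (ρ - 1) /
(s ^ ρ + λ)`, and Laplace transforms are injective (`eqOn_of_laplace_eq`). The computation needs the
Stieltjes transform `∫ K_λ(r) / (s + r) dr = 1 / (s ^ ρ + λ)` (`integral_mlDensity_div`), which is
Cauchy's theorem for `1 / (z ^ ρ + λ)` on the plane cut along the negative axis. Letting `s → 0`
there shows that `λ K_λ / r` has mass one, which gives the initial condition.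

For uniqueness, each coordinate `d` of a difference of solutions satisfies `∂^ρ d = -λ d` with zero
initial value. Integrating once and applying the fractional integral of order `ρ` gives a
homogeneous Volterra equation with weakly singular kernel for the primitive of `d`, which forces it
to vanish. -/

noncomputable section

namespace Subdiffusion

/-! ### Laplace transforms of densities bounded by a power. -/

section Laplace

variable {E : Type*} [NormedAddCommGroup E]

/-- `g` is strongly measurable on `(0, ∞)` and `‖g(r)‖ ≤ C r ^ a` there. -/
structure PowBound (g : ℝ → E) (C a : ℝ) : Prop where
  aesm : AEStronglyMeasurable g (volume.restrict (Ioi 0))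
  le : ∀ r : ℝ, 0 < r → ‖g r‖ ≤ C * r ^ a

lemma PowBound.nonneg {g : ℝ → E} {C a : ℝ} (h : PowBound g C a) : 0 ≤ C := by
  simpa using (norm_nonneg _).trans (h.le 1 one_pos)

variable [NormedSpace ℝ E]

/-- The Laplace transform `∫_0^∞ e^(-rt) g(r) dr`. -/
def laplace (g : ℝ → E) (t : ℝ) : E := ∫ r in Ioi (0 : ℝ), Real.exp (-(r * t)) • g r

lemma integrableOn_exp_mul_rpow {a t : ℝ} (ha : -1 < a) (ht : 0 < t) :
    IntegrableOn (fun r : ℝ => Real.exp (-(r * t)) * r ^ a) (Ioi 0) := by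
  refine (integrableOn_rpow_mul_exp_neg_mul_rpow ha one_pos ht).congr_fun (fun r _ => ?_)
    measurableSet_Ioi
  simp only [Real.rpow_one]
  rw [mul_comm, neg_mul, mul_comm t]

lemma integral_exp_mul_rpow {a t : ℝ} (ha : -1 < a) (ht : 0 < t) :
    ∫ r in Ioi (0 : ℝ), Real.exp (-(r * t)) * r ^ a = Real.Gamma (a + 1) * t ^ (-(a + 1)) := by
  have h := Real.integral_rpow_mul_exp_neg_mul_Ioi (a := a + 1) (by linarith) ht
  rw [add_sub_cancel_right] at h
  rw [Real.rpow_neg ht.le, ← Real.inv_rpow ht.le, ← one_div, mul_comm, ← h]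
  refine setIntegral_congr_fun measurableSet_Ioi fun r _ => ?_
  simp only [mul_comm]

namespace PowBound

variable {g : ℝ → E} {C a : ℝ}

lemma aesm_exp (h : PowBound g C a) (t : ℝ) :
    AEStronglyMeasurable (fun r : ℝ => Real.exp (-(r * t)) • g r) (volume.restrict (Ioi 0)) :=
  (by fun_prop : Continuous fun r : ℝ => Real.exp (-(r * t))).aestronglyMeasurable.smul h.aesm

lemma norm_exp_le (h : PowBound g C a) (t : ℝ) {r : ℝ} (hr : 0 < r) :
    ‖Real.exp (-(r * t)) • g r‖ ≤ C * (Real.exp (-(r * t)) * r ^ a) := by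
  rw [norm_smul, Real.norm_eq_abs, Real.abs_exp]
  have := mul_le_mul_of_nonneg_left (h.le r hr) (Real.exp_pos (-(r * t))).le
  linarith

lemma integrableOn (h : PowBound g C a) (ha : -1 < a) {t : ℝ} (ht : 0 < t) :
    IntegrableOn (fun r : ℝ => Real.exp (-(r * t)) • g r) (Ioi 0) :=
  Integrable.mono' ((integrableOn_exp_mul_rpow ha ht).const_mul C) (h.aesm_exp t)
    ((ae_restrict_iff' measurableSet_Ioi).2 (.of_forall fun _ hr => h.norm_exp_le t hr))

lemma norm_laplace_le (h : PowBound g C a) (ha : -1 < a) {t : ℝ} (ht : 0 < t) :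
    ‖laplace g t‖ ≤ C * Real.Gamma (a + 1) * t ^ (-(a + 1)) := by
  rw [mul_assoc, ← integral_exp_mul_rpow ha ht, ← integral_const_mul]
  exact norm_integral_le_of_norm_le ((integrableOn_exp_mul_rpow ha ht).const_mul C)
    ((ae_restrict_iff' measurableSet_Ioi).2 (.of_forall fun _ hr => h.norm_exp_le t hr))

lemma neg_pow_smul (h : PowBound g C a) (m : ℕ) :
    PowBound (fun r => (-r) ^ m • g r) C (a + m) where
  aesm := (by fun_prop : Continuous fun r : ℝ => (-r) ^ m).aestronglyMeasurable.smul h.aesm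
  le r hr := by
    rw [norm_smul, norm_pow, norm_neg, Real.norm_of_nonneg hr.le, Real.rpow_add hr,
      Real.rpow_natCast]
    have := mul_le_mul_of_nonneg_left (h.le r hr) (pow_nonneg hr.le m)
    linarith

lemma neg_smul (h : PowBound g C a) : PowBound (fun r => (-r) • g r) C (a + 1) := by
  simpa using h.neg_pow_smul 1

lemma hasDerivAt_laplace (h : PowBound g C a) (ha : -1 < a) {t : ℝ} (ht : 0 < t) :
    HasDerivAt (laplace g) (laplace (fun r => (-r) • g r) t) t := by
  have ha' : -1 < a + 1 := by linarith
  -- For `s > t / 2` the factor `e ^ (-rs)` is at most `e ^ (-rt/2)`, so one integrable bound serves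
  -- a whole neighbourhood of `t`.
  refine (hasDerivAt_integral_of_dominated_loc_of_deriv_le
    (F := fun t r => Real.exp (-(r * t)) • g r) (F' := fun t r => Real.exp (-(r * t)) • (-r) • g r)
    (bound := fun r => C * (Real.exp (-(r * (t / 2))) * r ^ (a + 1))) (Ioi_mem_nhds (half_lt_self ht))
    (.of_forall fun s => h.aesm_exp s) (h.integrableOn ha ht) (h.neg_smul.aesm_exp t) ?_
    ((integrableOn_exp_mul_rpow ha' (half_pos ht)).const_mul C) ?_).2
  · refine (ae_restrict_iff' measurableSet_Ioi).2 (.of_forall fun r (hr : 0 < r) s (hs : _ < s) => ?_)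
    refine (h.neg_smul.norm_exp_le s hr).trans ?_
    have := h.nonneg
    gcongr
  · refine .of_forall fun r s _ => ?_
    have h1 : HasDerivAt (fun s => Real.exp (-(r * s))) (Real.exp (-(r * s)) * -(r * 1)) s :=
      (((hasDerivAt_id s).const_mul r).neg).exp
    simpa [smul_smul] using h1.smul_const (g r)

/-- Each derivative multiplies the density by `-r` and raises the exponent by one, which keeps it
above `-1`; hence the induction runs over all `g` and `a`. -/
lemma contDiffOn_laplace (h : PowBound g C a) (ha : -1 < a) :
    ContDiffOn ℝ ∞ (laplace g) (Ioi 0) := by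
  rw [contDiffOn_infty]
  intro n
  induction n generalizing g a with
  | zero =>
    exact contDiffOn_zero.2 fun t ht => (h.hasDerivAt_laplace ha ht).continuousAt.continuousWithinAt
  | succ n ih =>
    push_cast
    refine (contDiffOn_succ_iff_deriv_of_isOpen isOpen_Ioi).2
      ⟨fun t ht => (h.hasDerivAt_laplace ha ht).differentiableAt.differentiableWithinAt,
        by simp, ?_⟩
    exact (ih h.neg_smul (by linarith)).congr fun t ht => (h.hasDerivAt_laplace ha ht).deriv

lemma continuousOn_laplace (h : PowBound g C a) (ha : -1 < a) :
    ContinuousOn (laplace g) (Ioi 0) :=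
  (h.contDiffOn_laplace ha).continuousOn

lemma iteratedDeriv_laplace (h : PowBound g C a) (ha : -1 < a) (m : ℕ) :
    EqOn (iteratedDeriv m (laplace g)) (laplace fun r => (-r) ^ m • g r) (Ioi 0) := by
  induction m with
  | zero => intro t _; simp
  | succ m ih =>
    intro t ht
    have hm : (0 : ℝ) ≤ m := m.cast_nonneg
    rw [iteratedDeriv_succ, (ih.eventuallyEq_of_mem (Ioi_mem_nhds ht)).deriv_eq,
      ((h.neg_pow_smul m).hasDerivAt_laplace (by linarith) ht).deriv]
    simp only [smul_smul, pow_succ']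

lemma norm_iteratedDeriv_laplace_le (h : PowBound g C a) (ha : -1 < a) (m : ℕ) {t : ℝ}
    (ht : 0 < t) :
    ‖iteratedDeriv m (laplace g) t‖ ≤ C * Real.Gamma (a + m + 1) * t ^ (-(a + m + 1)) := by
  have hm : (0 : ℝ) ≤ m := m.cast_nonneg
  rw [h.iteratedDeriv_laplace ha m ht]
  exact (h.neg_pow_smul m).norm_laplace_le (by linarith) ht

end PowBound

/-- Tonelli: the integral over the density variable is at most `C Γ(a + 1) t ^ (-(a + 1))`, and `a <
0` is what makes this power integrable at `t = 0`. -/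
lemma integrable_prod_laplace {g : ℝ → ℝ} {C a s : ℝ} (h : PowBound g C a) (ha : -1 < a)
    (ha0 : a < 0) (hs : 0 < s) :
    Integrable (fun p : ℝ × ℝ => Real.exp (-(p.1 * s)) * (Real.exp (-(p.2 * p.1)) * g p.2))
      ((volume.restrict (Ioi 0)).prod (volume.restrict (Ioi 0))) := by
  have hm : AEStronglyMeasurable
      (fun p : ℝ × ℝ => Real.exp (-(p.1 * s)) * (Real.exp (-(p.2 * p.1)) * g p.2))
      ((volume.restrict (Ioi 0)).prod (volume.restrict (Ioi 0))) :=
    (by fun_prop : Continuous fun p : ℝ × ℝ => Real.exp (-(p.1 * s))).aestronglyMeasurable.mul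
      ((by fun_prop : Continuous fun p : ℝ × ℝ =>
        Real.exp (-(p.2 * p.1))).aestronglyMeasurable.mul h.aesm.comp_snd)
  rw [integrable_prod_iff hm]
  constructor
  · refine (ae_restrict_iff' measurableSet_Ioi).2 (.of_forall fun t (ht : 0 < t) => ?_)
    exact (h.integrableOn ha ht).const_mul (Real.exp (-(t * s)))
  · refine Integrable.mono' ((integrableOn_exp_mul_rpow (a := -(a + 1)) (by linarith) hs).const_mul
      (C * Real.Gamma (a + 1))) hm.norm.integral_prod_right'
      ((ae_restrict_iff' measurableSet_Ioi).2 (.of_forall fun t (ht : 0 < t) => ?_))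
    rw [Real.norm_of_nonneg (integral_nonneg fun _ => norm_nonneg _)]
    simp only [norm_mul, Real.norm_eq_abs, Real.abs_exp]
    rw [integral_const_mul, mul_left_comm]
    refine mul_le_mul_of_nonneg_left ?_ (Real.exp_pos _).le
    rw [mul_assoc, ← integral_exp_mul_rpow ha ht, ← integral_const_mul]
    refine setIntegral_mono_on ?_ ((integrableOn_exp_mul_rpow ha ht).const_mul C)
      measurableSet_Ioi fun r hr => ?_
    · simpa [abs_mul, IntegrableOn] using (h.integrableOn ha ht).norm
    · simpa [abs_mul] using h.norm_exp_le t hr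

/-- By Fubini and `∫ e ^ (-t(s + r)) dt = 1 / (s + r)`, a twofold Laplace transform is a Stieltjes
transform. -/
lemma integral_exp_mul_laplace {g : ℝ → ℝ} {C a s : ℝ} (h : PowBound g C a) (ha : -1 < a)
    (ha0 : a < 0) (hs : 0 < s) :
    IntegrableOn (fun t => Real.exp (-(t * s)) * laplace g t) (Ioi 0) ∧
    IntegrableOn (fun r => g r / (s + r)) (Ioi 0) ∧
    ∫ t in Ioi (0 : ℝ), Real.exp (-(t * s)) * laplace g t = ∫ r in Ioi (0 : ℝ), g r / (s + r) := by
  have hi := integrable_prod_laplace h ha ha0 hs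
  have h1 (t : ℝ) : ∫ r in Ioi (0 : ℝ), Real.exp (-(t * s)) * (Real.exp (-(r * t)) * g r) =
      Real.exp (-(t * s)) * laplace g t := by
    rw [integral_const_mul]; rfl
  have h2 : ∀ r ∈ Ioi (0 : ℝ), ∫ t in Ioi (0 : ℝ),
      Real.exp (-(t * s)) * (Real.exp (-(r * t)) * g r) = g r / (s + r) := fun r (hr : 0 < r) => by
    have h3 := integral_exp_mul_rpow (a := 0) (t := s + r) (by norm_num) (by positivity)
    simp only [Real.rpow_zero, mul_one, zero_add, Real.Gamma_one, one_mul, Real.rpow_neg_one] at h3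
    rw [div_eq_inv_mul, ← h3, ← integral_mul_const]
    congr 1 with t
    rw [← mul_assoc, ← Real.exp_add]
    ring_nf
  refine ⟨?_, ?_, ?_⟩
  · have := hi.integral_prod_left
    simpa only [h1, IntegrableOn] using this
  · have := hi.integral_prod_right
    exact (integrableOn_congr_fun h2 measurableSet_Ioi).1 this
  · rw [← setIntegral_congr_fun measurableSet_Ioi h2]
    simp_rw [← h1]
    exact integral_integral_swap hi

end Laplace

/-! ### Injectivity of the Laplace transform. -/

section LaplaceInjective

open ProbabilityTheory Complex

/-- Both moment generating functions extend holomorphically to a common vertical strip around the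
imaginary axis. The identity theorem carries the agreement at real points near `0` to the whole
strip, and on the imaginary axis it is equality of characteristic functions. -/
lemma measure_ext_of_eventually_mgf_eq {μ ν : Measure ℝ} [IsFiniteMeasure μ] [IsFiniteMeasure ν]
    (hμ : (0 : ℝ) ∈ interior (integrableExpSet id μ))
    (hν : (0 : ℝ) ∈ interior (integrableExpSet id ν))
    (h : ∀ᶠ t in 𝓝 0, mgf id μ t = mgf id ν t) : μ = ν := by
  set U := interior (integrableExpSet (id : ℝ → ℝ) μ) ∩ interior (integrableExpSet (id : ℝ → ℝ) ν)
  have hU : Convex ℝ U := convex_integrableExpSet.interior.inter convex_integrableExpSet.interior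
  have hX : AnalyticOnNhd ℂ (complexMGF id μ) {z | z.re ∈ U} :=
    fun z hz => analyticOnNhd_complexMGF z hz.1
  have hY : AnalyticOnNhd ℂ (complexMGF id ν) {z | z.re ∈ U} :=
    fun z hz => analyticOnNhd_complexMGF z hz.2
  have key : EqOn (complexMGF id μ) (complexMGF id ν) {z | z.re ∈ U} := by
    refine AnalyticOnNhd.eqOn_of_preconnected_of_frequently_eq hX hY
      (hU.linear_preimage reLm).isPreconnected (z₀ := ((0 : ℝ) : ℂ)) ⟨by simpa, by simpa⟩ ?_
    have h_real : ∃ᶠ (x : ℝ) in 𝓝[≠] 0, complexMGF id μ x = complexMGF id ν x := by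
      refine (h.filter_mono nhdsWithin_le_nhds).frequently.mono fun y hy ↦ ?_
      rw [complexMGF_ofReal, complexMGF_ofReal, hy]
    rw [frequently_iff_seq_forall] at h_real ⊢
    obtain ⟨xs, hx_tendsto, hx_eq⟩ := h_real
    refine ⟨fun n ↦ xs n, ?_, fun n ↦ by simp [hx_eq]⟩
    rw [tendsto_nhdsWithin_iff] at hx_tendsto ⊢
    exact ⟨tendsto_ofReal_iff.2 hx_tendsto.1, by simpa using hx_tendsto.2⟩
  refine Measure.ext_of_charFun (funext fun x => ?_)
  rw [← complexMGF_id_mul_I, ← complexMGF_id_mul_I]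
  exact key ⟨by simpa, by simpa⟩

/-- Injectivity of the Laplace transform on nonnegative continuous functions on `(0, ∞)`. -/
lemma eqOn_of_laplace_eq {f g : ℝ → ℝ} (hf : ContinuousOn f (Ioi 0)) (hg : ContinuousOn g (Ioi 0))
    (hf0 : ∀ t, 0 < t → 0 ≤ f t) (hg0 : ∀ t, 0 < t → 0 ≤ g t)
    (hfi : ∀ s : ℝ, 0 < s → IntegrableOn (fun t => Real.exp (-(t * s)) * f t) (Ioi 0))
    (hgi : ∀ s : ℝ, 0 < s → IntegrableOn (fun t => Real.exp (-(t * s)) * g t) (Ioi 0))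
    (h : ∀ s : ℝ, 0 < s → ∫ t in Ioi (0 : ℝ), Real.exp (-(t * s)) * f t =
      ∫ t in Ioi (0 : ℝ), Real.exp (-(t * s)) * g t) : EqOn f g (Ioi 0) := by
  -- The tilt by `e ^ (-t)` makes `f` the density of a finite measure, whose moment generating
  -- function at `x < 1` is the Laplace transform of `f` at `1 - x`; in particular it is finite near
  -- `0`.
  let F (f : ℝ → ℝ) (t : ℝ) : ℝ := Real.exp (-(t * 1)) * f t
  let m (f : ℝ → ℝ) : Measure ℝ :=
    (volume.restrict (Ioi 0)).withDensity fun t => ENNReal.ofReal (F f t)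
  have fin : ∀ f : ℝ → ℝ, IntegrableOn (fun t => Real.exp (-(t * 1)) * f t) (Ioi 0) →
      IsFiniteMeasure (m f) := fun f hf =>
    isFiniteMeasure_withDensity_ofReal hf.2
  have hm {f : ℝ → ℝ} (hf : ContinuousOn f (Ioi 0)) :
      AEMeasurable (fun t => ENNReal.ofReal (F f t)) (volume.restrict (Ioi 0)) :=
    ((by fun_prop : Continuous fun t : ℝ => Real.exp (-(t * 1))).aemeasurable.mul
      (hf.aemeasurable measurableSet_Ioi)).ennreal_ofReal
  have aux {f : ℝ → ℝ} (hf0 : ∀ t, 0 < t → 0 ≤ f t) (x : ℝ) : ∀ t ∈ Ioi (0 : ℝ),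
      (ENNReal.ofReal (F f t)).toReal • Real.exp (x * t) = Real.exp (-(t * (1 - x))) * f t := by
    intro t ht
    rw [ENNReal.toReal_ofReal (mul_nonneg (Real.exp_pos _).le (hf0 t ht)), smul_eq_mul,
      mul_right_comm, ← Real.exp_add]
    ring_nf
  have hint {f : ℝ → ℝ} (hf : ContinuousOn f (Ioi 0)) (hf0 : ∀ t, 0 < t → 0 ≤ f t)
      (hfi : ∀ s : ℝ, 0 < s → IntegrableOn (fun t => Real.exp (-(t * s)) * f t) (Ioi 0)) :
      (0 : ℝ) ∈ interior (integrableExpSet id (m f)) := by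
    refine mem_interior.2 ⟨Iio 1, fun x (hx : x < 1) => ?_, isOpen_Iio, by simp⟩
    change Integrable (fun t => Real.exp (x * id t)) (m f)
    rw [integrable_withDensity_iff_integrable_smul₀' (hm hf) (by simp)]
    exact (integrableOn_congr_fun (aux hf0 x) measurableSet_Ioi).2 (hfi (1 - x) (by linarith))
  have hmgf {f : ℝ → ℝ} (hf : ContinuousOn f (Ioi 0)) (hf0 : ∀ t, 0 < t → 0 ≤ f t) (x : ℝ) :
      mgf id (m f) x = ∫ t in Ioi (0 : ℝ), Real.exp (-(t * (1 - x))) * f t := by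
    rw [mgf, integral_withDensity_eq_integral_toReal_smul₀ (hm hf) (by simp)]
    exact setIntegral_congr_fun measurableSet_Ioi (aux hf0 x)
  have := fin f (hfi 1 one_pos)
  have := fin g (hgi 1 one_pos)
  have hE : m f = m g := by
    refine measure_ext_of_eventually_mgf_eq (hint hf hf0 hfi) (hint hg hg0 hgi) ?_
    filter_upwards [Iio_mem_nhds one_pos] with x hx
    rw [hmgf hf hf0, hmgf hg hg0, h (1 - x) (sub_pos.2 hx)]
  have hae := (withDensity_eq_iff (hm hf) (hm hg) ?_).1 hE
  · refine Measure.eqOn_open_of_ae_eq (μ := volume) ?_ isOpen_Ioi hf hg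
    filter_upwards [hae, ae_restrict_mem measurableSet_Ioi] with t ht ht0
    have := (ENNReal.ofReal_eq_ofReal_iff (mul_nonneg (Real.exp_pos _).le (hf0 t ht0))
      (mul_nonneg (Real.exp_pos _).le (hg0 t ht0))).1 ht
    exact mul_left_cancel₀ (Real.exp_pos _).ne' this
  · exact (hfi 1 one_pos).lintegral_lt_top.ne

end LaplaceInjective

/-! ### Bounds for the spectral density, uniform in the eigenvalue. -/

section Density

/-- The spectral density of `t ^ (ρ - 1) E_{ρ,ρ}(-lam t ^ ρ)`, which is its Laplace transform. -/
def mlDensity (ρ lam r : ℝ) : ℝ :=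
  Real.sin (Real.pi * ρ) / Real.pi *
    (r ^ ρ / ((r ^ ρ) ^ 2 + 2 * lam * r ^ ρ * Real.cos (Real.pi * ρ) + lam ^ 2))

/-- The constant in the bounds of `mlDensity`. -/
def mlConst (ρ : ℝ) : ℝ :=
  Real.sin (Real.pi * ρ) / Real.pi * (1 - |Real.cos (Real.pi * ρ)|)⁻¹

variable {ρ lam : ℝ}

lemma sin_pi_mul_pos (h0 : 0 < ρ) (h1 : ρ < 1) : 0 < Real.sin (Real.pi * ρ) :=
  Real.sin_pos_of_pos_of_lt_pi (by positivity) (by nlinarith [Real.pi_pos])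

lemma abs_cos_pi_mul_lt_one (h0 : 0 < ρ) (h1 : ρ < 1) : |Real.cos (Real.pi * ρ)| < 1 := by
  rw [← sq_lt_one_iff_abs_lt_one]
  nlinarith [Real.sin_sq_add_cos_sq (Real.pi * ρ), sin_pi_mul_pos h0 h1]

lemma mlConst_pos (h0 : 0 < ρ) (h1 : ρ < 1) : 0 < mlConst ρ := by
  have := sin_pi_mul_pos h0 h1
  have := sub_pos.2 (abs_cos_pi_mul_lt_one h0 h1)
  unfold mlConst
  positivity

/-- From `2 lam y |c| ≤ |c| (y ^ 2 + lam ^ 2)`. With `c = cos(πρ)`, `|c| < 1`, this is the source of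
the factor `(1 - |cos(πρ)|)⁻¹` in `mlConst`. -/
lemma mlDensity_denom_ge {y c : ℝ} (hy : 0 < y) (hl : 0 < lam) :
    (1 - |c|) * (y ^ 2 + lam ^ 2) ≤ y ^ 2 + 2 * lam * y * c + lam ^ 2 := by
  have h2 : 0 < lam * y := mul_pos hl hy
  nlinarith [neg_abs_le c, abs_nonneg c, mul_nonneg (abs_nonneg c) (sq_nonneg (y - lam)),
    mul_nonneg h2.le (by linarith [neg_abs_le c] : 0 ≤ c + |c|)]

lemma mlDensity_nonneg (h0 : 0 < ρ) (h1 : ρ < 1) (hl : 0 < lam) {r : ℝ} (hr : 0 < r) :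
    0 ≤ mlDensity ρ lam r := by
  have hy : 0 < r ^ ρ := Real.rpow_pos_of_pos hr ρ
  have h2 := mlDensity_denom_ge (c := Real.cos (Real.pi * ρ)) hy hl
  have h3 := sin_pi_mul_pos h0 h1
  have h4 := sub_pos.2 (abs_cos_pi_mul_lt_one h0 h1)
  have h5 : 0 < (r ^ ρ) ^ 2 + 2 * lam * r ^ ρ * Real.cos (Real.pi * ρ) + lam ^ 2 :=
    lt_of_lt_of_le (by positivity) h2
  unfold mlDensity
  positivity

lemma mlDensity_le (h0 : 0 < ρ) (h1 : ρ < 1) (hl : 0 < lam) {r : ℝ} (hr : 0 < r) :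
    mlDensity ρ lam r ≤ mlConst ρ * (r ^ ρ / ((r ^ ρ) ^ 2 + lam ^ 2)) := by
  have hy : 0 < r ^ ρ := Real.rpow_pos_of_pos hr ρ
  have h2 := mlDensity_denom_ge (c := Real.cos (Real.pi * ρ)) hy hl
  have h3 := sin_pi_mul_pos h0 h1
  have h4 := sub_pos.2 (abs_cos_pi_mul_lt_one h0 h1)
  unfold mlDensity mlConst
  rw [mul_assoc (_ / _)]
  have h5 : 0 ≤ Real.sin (Real.pi * ρ) / Real.pi := by positivity
  refine mul_le_mul_of_nonneg_left ?_ h5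
  rw [← div_eq_inv_mul, div_div]
  refine div_le_div_of_nonneg_left hy.le (by positivity) ?_
  rwa [mul_comm]

lemma measurable_mlDensity : Measurable (mlDensity ρ lam) := by
  unfold mlDensity
  fun_prop

lemma mlDensity_le_rpow (h0 : 0 < ρ) (h1 : ρ < 1) (hl : 0 < lam) {r : ℝ} (hr : 0 < r) :
    mlDensity ρ lam r ≤ mlConst ρ * r ^ (-ρ) := by
  refine (mlDensity_le h0 h1 hl hr).trans
    (mul_le_mul_of_nonneg_left ?_ (mlConst_pos h0 h1).le)
  have hy : 0 < r ^ ρ := Real.rpow_pos_of_pos hr ρ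
  rw [Real.rpow_neg hr.le, div_le_iff₀ (by positivity), mul_add, pow_two, inv_mul_cancel_left₀ hy.ne']
  have : 0 ≤ (r ^ ρ)⁻¹ * lam ^ 2 := by positivity
  linarith

/-- From `lam y ≤ y ^ 2 + lam ^ 2` with `y = r ^ ρ`. Uniformity in `lam` is what puts the solution
in the domain of `A` for every `φ`. -/
lemma mul_mlDensity_le (h0 : 0 < ρ) (h1 : ρ < 1) (hl : 0 < lam) {r : ℝ} (hr : 0 < r) :
    lam * mlDensity ρ lam r ≤ mlConst ρ := by
  have h := mul_le_mul_of_nonneg_left (mlDensity_le h0 h1 hl hr) hl.le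
  refine h.trans ?_
  have hy : 0 < r ^ ρ := Real.rpow_pos_of_pos hr ρ
  have : lam * (r ^ ρ / ((r ^ ρ) ^ 2 + lam ^ 2)) ≤ 1 := by
    rw [mul_div_assoc', div_le_one (by positivity)]
    nlinarith [sq_nonneg (r ^ ρ - lam), mul_pos hl hy]
  nlinarith [mlConst_pos h0 h1]

/-- Here `lam l ≤ lam ^ 2 ≤ y ^ 2 + lam ^ 2` with `y = r ^ ρ`. Only a lower bound `l` of the
spectrum enters, and the exponent `ρ - 1` is integrable at `0`. -/
lemma mul_mlDensity_div_le (h0 : 0 < ρ) (h1 : ρ < 1) {l : ℝ} (hl0 : 0 < l) (hl : l ≤ lam) {r : ℝ}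
    (hr : 0 < r) : lam * mlDensity ρ lam r / r ≤ mlConst ρ / l * r ^ (ρ - 1) := by
  have hl' := hl0.trans_le hl
  have hc := mlConst_pos h0 h1
  have hy : 0 < r ^ ρ := Real.rpow_pos_of_pos hr ρ
  rw [Real.rpow_sub_one hr.ne', mul_div_assoc', div_le_div_iff_of_pos_right hr]
  refine (mul_le_mul_of_nonneg_left (mlDensity_le h0 h1 hl' hr) hl'.le).trans ?_
  have : lam * (r ^ ρ / ((r ^ ρ) ^ 2 + lam ^ 2)) ≤ r ^ ρ / l := by
    rw [mul_div_assoc', div_le_div_iff₀ (by positivity) hl0, mul_comm lam, mul_assoc]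
    refine mul_le_mul_of_nonneg_left ?_ hy.le
    nlinarith [sq_nonneg (r ^ ρ)]
  rw [mul_left_comm, div_mul_eq_mul_div, mul_div_assoc]
  exact mul_le_mul_of_nonneg_left this hc.le

lemma powBound_mlDensity (h0 : 0 < ρ) (h1 : ρ < 1) (hl : 0 < lam) :
    PowBound (mlDensity ρ lam) (mlConst ρ) (-ρ) where
  aesm := measurable_mlDensity.aestronglyMeasurable
  le r hr := by
    rw [Real.norm_of_nonneg (mlDensity_nonneg h0 h1 hl hr)]
    exact mlDensity_le_rpow h0 h1 hl hr

lemma powBound_mul_mlDensity_div (h0 : 0 < ρ) (h1 : ρ < 1) (hl : 0 < lam) :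
    PowBound (fun r => lam * mlDensity ρ lam r / r) (mlConst ρ / lam) (ρ - 1) where
  aesm := ((measurable_mlDensity.const_mul lam).div measurable_id).aestronglyMeasurable
  le r hr := by
    rw [Real.norm_of_nonneg
      (div_nonneg (mul_nonneg hl.le (mlDensity_nonneg h0 h1 hl hr)) hr.le)]
    exact mul_mlDensity_div_le h0 h1 hl le_rfl hr

end Density

/-! ### The Stieltjes transform of the density, by Cauchy's theorem in logarithmic coordinates. -/

section Stieltjes

open Complex

lemma tendsto_intervalIntegral_comp_exp {k : ℝ → ℝ} (hk : IntegrableOn k (Ioi 0)) :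
    Tendsto (fun R : ℝ => ∫ x in (-R)..R, Real.exp x * k (Real.exp x)) atTop
      (𝓝 (∫ r in Ioi (0 : ℝ), k r)) := by
  have hd : ∀ x ∈ (univ : Set ℝ), HasDerivWithinAt Real.exp (Real.exp x) univ x :=
    fun x _ => (Real.hasDerivAt_exp x).hasDerivWithinAt
  have hr : Real.exp '' univ = Ioi 0 := by rw [image_univ, Real.range_exp]
  rw [← hr] at hk ⊢
  rw [integral_image_eq_integral_abs_deriv_smul .univ hd Real.exp_injective.injOn]
  rw [integrableOn_image_iff_integrableOn_abs_deriv_smul .univ hd Real.exp_injective.injOn] at hk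
  simp only [Real.abs_exp, smul_eq_mul, integrableOn_univ, setIntegral_univ] at hk ⊢
  exact intervalIntegral_tendsto_integral hk tendsto_neg_atTop_atBot tendsto_id

/-- The function `(z ^ ρ + lam)⁻¹` in the coordinate `w = log z`. -/
def logResolvent (ρ lam : ℝ) (w : ℂ) : ℂ := (exp (ρ * w) + lam)⁻¹

variable {ρ lam s : ℝ}

/-- A zero would require `ρ * w.im` to be an odd multiple of `π`. As `ρ < 1`, the open strip
contains the closed strip `|w.im| ≤ π`, the image of the cut plane with both edges of the cut. -/
lemma exp_add_ne_zero (h0 : 0 < ρ) (hl : 0 < lam) {w : ℂ} (hw : |w.im| < Real.pi / ρ) :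
    exp (ρ * w) + lam ≠ 0 := by
  intro h
  have him : (ρ * w).im = ρ * w.im := by simp
  have hre : (ρ * w).re = ρ * w.re := by simp
  have h1 := congrArg re h
  have h2 := congrArg im h
  rw [add_im, exp_im, him, hre, ofReal_im, add_zero, zero_im] at h2
  rw [add_re, exp_re, him, hre, ofReal_re, zero_re] at h1
  have h3 : Real.sin (ρ * w.im) = 0 := (mul_eq_zero.1 h2).resolve_left (Real.exp_pos _).ne'
  have h4 : |ρ * w.im| < Real.pi := by
    rw [abs_mul, abs_of_pos h0, mul_comm]
    exact (lt_div_iff₀ h0).1 hw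
  have h5 := (Real.sin_eq_zero_iff_of_lt_of_lt (abs_lt.1 h4).1 (abs_lt.1 h4).2).1 h3
  rw [h5, Real.cos_zero] at h1
  nlinarith [Real.exp_pos (ρ * w.re)]

lemma exp_sub_ne_zero (hs : 0 < s) {w : ℂ} (hw : |w.im| ≤ Real.pi) (hne : w ≠ Real.log s) :
    exp w - s ≠ 0 := by
  intro h
  have h1 : exp w = exp (Real.log s : ℂ) := by
    rw [← ofReal_exp, Real.exp_log hs]; exact sub_eq_zero.1 h
  obtain ⟨n, hn⟩ := exp_eq_exp_iff_exists_int.1 h1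
  have h2 : w.im = n * (2 * Real.pi) := by rw [hn]; simp
  have h3 : n = 0 := by
    by_contra h4
    have h5 : (1 : ℝ) ≤ |(n : ℝ)| := by exact_mod_cast Int.one_le_abs h4
    rw [h2, abs_mul, abs_of_pos Real.two_pi_pos] at hw
    nlinarith [Real.pi_pos]
  rw [h3] at hn
  exact hne (by simpa using hn)

/-- The boundary integrand of the Cauchy integral for `(z ^ ρ + lam)⁻¹` in logarithmic
coordinates. -/
def cauchyQuot (ρ lam s : ℝ) (w : ℂ) : ℂ :=
  (logResolvent ρ lam w - logResolvent ρ lam ((Real.log s : ℝ) : ℂ)) * exp w / (exp w - s)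

lemma logResolvent_log (hs : 0 < s) :
    logResolvent ρ lam (Real.log s : ℝ) = ((s ^ ρ + lam)⁻¹ : ℝ) := by
  rw [logResolvent, ← ofReal_mul, ← ofReal_exp, Real.rpow_def_of_pos hs, mul_comm]
  push_cast
  rfl

/-- Subtracting the value of the resolvent at `log s` makes the only pole of the quotient in the
strip removable, so no residue is needed; the subtracted value returns as the limit over the right
side of the rectangle. -/
lemma cauchyQuot_rect (h0 : 0 < ρ) (h1 : ρ < 1) (hl : 0 < lam) (hs : 0 < s) {R : ℝ}
    (hR : |Real.log s| < R) :
    (∫ x in (-R)..R, cauchyQuot ρ lam s (x + (-Real.pi : ℝ) * I)) -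
      (∫ x in (-R)..R, cauchyQuot ρ lam s (x + (Real.pi : ℝ) * I)) +
      I • (∫ y in (-Real.pi)..Real.pi, cauchyQuot ρ lam s ((R : ℝ) + y * I)) -
      I • (∫ y in (-Real.pi)..Real.pi, cauchyQuot ρ lam s ((-R : ℝ) + y * I)) = 0 := by
  set w₀ : ℂ := ((Real.log s : ℝ) : ℂ) with hw₀
  let N : ℂ → ℂ := fun w => (logResolvent ρ lam w - logResolvent ρ lam w₀) * exp w
  let D : ℂ → ℂ := fun w => exp w - s
  let S : Set ℂ := {w | |w.im| < Real.pi / ρ}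
  have hSo : IsOpen S := isOpen_lt (by fun_prop) continuous_const
  have hpi := Real.pi_pos
  have hN : DifferentiableOn ℂ N S := by
    intro w hw
    have := exp_add_ne_zero h0 hl hw
    refine DifferentiableAt.differentiableWithinAt ?_
    simp only [N, logResolvent]
    fun_prop (disch := assumption)
  have hD : Differentiable ℂ D := by fun_prop
  have hD0 : D w₀ = 0 := by
    simp only [D, hw₀]
    rw [← ofReal_exp, Real.exp_log hs, sub_self]
  have hN0 : N w₀ = 0 := by simp [N]
  have hw₀S : w₀ ∈ S := by simp only [S, hw₀, mem_ofPred_eq, ofReal_im, abs_zero]; positivity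
  -- Numerator and denominator both vanish at `w₀`; the quotient of their difference quotients is
  -- the holomorphic extension of `cauchyQuot` across it.
  let G : ℂ → ℂ := fun w => dslope N w₀ w / dslope D w₀ w
  have hG {w : ℂ} (hw : w ≠ w₀) : G w = cauchyQuot ρ lam s w := by
    simp only [G, dslope_of_ne _ hw, slope_def_field, hN0, hD0, sub_zero]
    rw [div_div_div_cancel_right₀ (sub_ne_zero.2 hw)]
    rfl
  have key := integral_boundary_rect_eq_zero_of_differentiableOn G (-R + (-Real.pi : ℝ) * I)
    (R + (Real.pi : ℝ) * I) ?_
  · have hR0 : 0 < R := (abs_nonneg _).trans_lt hR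
    simp only [add_re, add_im, neg_re, neg_im, ofReal_re, ofReal_im, mul_re, mul_im, I_re, I_im,
      mul_zero, mul_one, neg_zero, sub_zero, add_zero, zero_add] at key
    rw [← key]
    have hlog := abs_lt.1 hR
    congr 1
    · congr 1
      · congr 1
        · refine intervalIntegral.integral_congr fun x _ => (hG fun h => ?_).symm
          have := congrArg im h
          simp [hw₀] at this
        · refine intervalIntegral.integral_congr fun x _ => (hG fun h => ?_).symm
          have := congrArg im h
          simp [hw₀] at this
      · congr 1
        refine intervalIntegral.integral_congr fun x _ => (hG fun h => ?_).symm
        have := congrArg re h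
        simp [hw₀] at this
        linarith
    · congr 1
      refine intervalIntegral.integral_congr fun x _ => (hG fun h => ?_).symm
      have := congrArg re h
      simp [hw₀] at this
      linarith
  · intro w hw
    have him : |w.im| ≤ Real.pi := by
      have := hw.2
      simp only [mem_preimage, add_im, neg_im, ofReal_im, mul_im, ofReal_re, I_im, mul_one, I_re,
        mul_zero, add_zero, neg_zero, zero_add] at this
      rw [uIcc_of_le (by linarith)] at this
      exact abs_le.2 this
    have hwS : w ∈ S := lt_of_le_of_lt him (by rw [lt_div_iff₀ h0]; nlinarith)
    refine DifferentiableWithinAt.div ?_ ?_ ?_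
    · exact (((differentiableOn_dslope (hSo.mem_nhds hw₀S)).2 hN).differentiableAt
        (hSo.mem_nhds hwS)).differentiableWithinAt
    · exact (((differentiableOn_dslope univ_mem).2 hD.differentiableOn).differentiableAt
        univ_mem).differentiableWithinAt
    · rcases eq_or_ne w w₀ with h | hne
      · rw [h, dslope_same]
        have : deriv D w₀ = exp w₀ := by simp [D]
        rw [this]
        exact exp_ne_zero _
      · rw [dslope_of_ne _ hne, slope_def_field, hD0, sub_zero]
        exact div_ne_zero (exp_sub_ne_zero hs him hne) (sub_ne_zero.2 hne)

/-- On both edges `e ^ w = -e ^ x`, so the subtracted constant cancels and only the jump of `1 / (z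
^ ρ + lam)` across the cut remains. The two denominators are conjugate, and their product is the
denominator of `mlDensity`. -/
lemma cauchyQuot_sub_cauchyQuot (h0 : 0 < ρ) (h1 : ρ < 1) (hl : 0 < lam) (hs : 0 < s) (x : ℝ) :
    cauchyQuot ρ lam s (x + (-Real.pi : ℝ) * I) - cauchyQuot ρ lam s (x + (Real.pi : ℝ) * I) =
      (2 * Real.pi * I) *
        ((Real.exp x * (mlDensity ρ lam (Real.exp x) / (s + Real.exp x)) : ℝ) : ℂ) := by
  have hpi := Real.pi_pos
  have hlt : Real.pi < Real.pi / ρ := by rw [lt_div_iff₀ h0]; nlinarith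
  have e1 : exp (x + (-Real.pi : ℝ) * I) = -(Real.exp x : ℂ) := by
    rw [exp_add, ofReal_neg, neg_mul, exp_neg, exp_pi_mul_I, ofReal_exp]; norm_num
  have e2 : exp (x + (Real.pi : ℝ) * I) = -(Real.exp x : ℂ) := by
    rw [exp_add, exp_pi_mul_I, ofReal_exp]; norm_num
  have d1 := exp_add_ne_zero (w := x + (-Real.pi : ℝ) * I) h0 hl
    (by simpa [abs_of_pos hpi] using hlt)
  have d2 := exp_add_ne_zero (w := x + (Real.pi : ℝ) * I) h0 hl
    (by simpa [abs_of_pos hpi] using hlt)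
  have hy : (Real.exp x) ^ ρ = Real.exp (ρ * x) := by rw [← Real.exp_mul, mul_comm]
  set y : ℝ := Real.exp (ρ * x) with hydef
  set c : ℝ := Real.cos (Real.pi * ρ) with hc
  set σ : ℝ := Real.sin (Real.pi * ρ) with hσ
  have f1 : exp (ρ * (x + (-Real.pi : ℝ) * I)) = y * (c - σ * I) := by
    rw [hydef, hc, hσ, ofReal_exp, ofReal_cos, ofReal_sin,
      show (ρ : ℂ) * (x + (-Real.pi : ℝ) * I) = ((ρ * x : ℝ) : ℂ) + (-(Real.pi * ρ : ℝ) : ℂ) * I by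
        push_cast; ring, exp_add, exp_mul_I, cos_neg, sin_neg]
    ring
  have f2 : exp (ρ * (x + (Real.pi : ℝ) * I)) = y * (c + σ * I) := by
    rw [hydef, hc, hσ, ofReal_exp, ofReal_cos, ofReal_sin,
      show (ρ : ℂ) * (x + (Real.pi : ℝ) * I) = ((ρ * x : ℝ) : ℂ) + ((Real.pi * ρ : ℝ) : ℂ) * I by
        push_cast; ring, exp_add, exp_mul_I]
  rw [f1] at d1
  rw [f2] at d2
  have hy0 : 0 < y := Real.exp_pos _
  have h4 := sub_pos.2 (abs_cos_pi_mul_lt_one h0 h1)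
  have hq : 0 < y ^ 2 + 2 * lam * y * c + lam ^ 2 :=
    lt_of_lt_of_le (by positivity) (mlDensity_denom_ge (c := c) hy0 hl)
  have hqc : (y : ℂ) ^ 2 + 2 * lam * y * c + lam ^ 2 ≠ 0 := by exact_mod_cast hq.ne'
  have hsc : (σ : ℂ) ^ 2 + (c : ℂ) ^ 2 = 1 := by exact_mod_cast Real.sin_sq_add_cos_sq _
  have hsx : (s : ℂ) + Real.exp x ≠ 0 := by
    exact_mod_cast (add_pos hs (Real.exp_pos x)).ne'
  have hpic : (Real.pi : ℂ) ≠ 0 := by exact_mod_cast hpi.ne'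
  have hprod : (y * (c - σ * I) + lam) * (y * (c + σ * I) + lam) =
      (y : ℂ) ^ 2 + 2 * lam * y * c + lam ^ 2 := by
    linear_combination (y : ℂ) ^ 2 * hsc - (y : ℂ) ^ 2 * σ ^ 2 * I_sq
  have hdiff : (y * (c - σ * I) + lam : ℂ)⁻¹ - (y * (c + σ * I) + lam)⁻¹ =
      2 * I * (σ * y / (y ^ 2 + 2 * lam * y * c + lam ^ 2)) := by
    rw [inv_sub_inv d1 d2, hprod]
    ring
  simp only [cauchyQuot]
  rw [e1, e2, ← sub_div, ← sub_mul, sub_sub_sub_cancel_right]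
  simp only [logResolvent]
  rw [f1, f2, hdiff, mlDensity, hy, ← hc, ← hσ]
  push_cast
  rw [← ofReal_exp]
  have hneg : -(Real.exp x : ℂ) - s = -(s + Real.exp x) := by ring
  rw [hneg]
  field_simp

/-- Far to the right the resolvent tends to `0` and `e ^ w / (e ^ w - s)` to `1`, so the integrand
tends uniformly to `-F₀` on a segment of length `2π`; `ε R` bounds the error. -/
lemma tendsto_vertical_right (hl : 0 < lam) (h0 : 0 < ρ) (hs : 0 < s) :
    Tendsto (fun R : ℝ => ∫ y in (-Real.pi)..Real.pi, cauchyQuot ρ lam s ((R : ℝ) + y * I)) atTop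
      (𝓝 (-(2 * Real.pi * logResolvent ρ lam (Real.log s : ℝ)))) := by
  set F₀ := logResolvent ρ lam (Real.log s : ℝ) with hF₀
  let ε : ℝ → ℝ := fun R =>
    ((Real.exp (ρ * R) - lam)⁻¹ + ‖F₀‖ * s * Real.exp (-R)) / (1 - s * Real.exp (-R))
  have hexp : Tendsto (fun R : ℝ => Real.exp (-R)) atTop (𝓝 0) :=
    Real.tendsto_exp_neg_atTop_nhds_zero
  have hexp' : Tendsto (fun R : ℝ => Real.exp (ρ * R)) atTop atTop :=
    Real.tendsto_exp_atTop.comp (tendsto_id.const_mul_atTop h0)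
  have hε : Tendsto ε atTop (𝓝 0) := by
    have h1 : Tendsto (fun R : ℝ => (Real.exp (ρ * R) - lam)⁻¹) atTop (𝓝 0) :=
      tendsto_inv_atTop_zero.comp (tendsto_atTop_add_const_right _ (-lam) hexp')
    have h2 := (h1.add (hexp.const_mul (‖F₀‖ * s))).div (tendsto_const_nhds.sub (hexp.const_mul s))
      (by norm_num : (1 : ℝ) - s * 0 ≠ 0)
    simp only [mul_zero, add_zero, zero_div] at h2
    exact h2
  rw [tendsto_iff_norm_sub_tendsto_zero]
  have hε' : Tendsto (fun R => ε R * |Real.pi - -Real.pi|) atTop (𝓝 0) := by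
    simpa using hε.mul_const _
  refine squeeze_zero' (.of_forall fun _ => norm_nonneg _) ?_ hε'
  have hsm : ∀ᶠ R in atTop, s * Real.exp (-R) < 1 := by
    have := hexp.const_mul s
    rw [mul_zero] at this
    exact this.eventually_lt_const one_pos
  filter_upwards [hexp'.eventually_gt_atTop lam, hsm] with R h1 h2
  have hden (y : ℝ) : ‖exp ((R : ℝ) + y * I) - s‖ ≥ Real.exp R * (1 - s * Real.exp (-R)) := by
    have h3 := norm_sub_norm_le (exp ((R : ℝ) + y * I)) (s : ℂ)
    rw [norm_exp, norm_real, Real.norm_of_nonneg hs.le] at h3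
    have h4 : Real.exp R * (1 - s * Real.exp (-R)) = Real.exp R - s := by
      rw [mul_sub, mul_left_comm, ← Real.exp_add]; simp
    rw [h4]
    simpa using h3
  have hpos : 0 < Real.exp R * (1 - s * Real.exp (-R)) :=
    mul_pos (Real.exp_pos R) (by linarith)
  have hF (y : ℝ) : ‖logResolvent ρ lam ((R : ℝ) + y * I)‖ ≤ (Real.exp (ρ * R) - lam)⁻¹ := by
    rw [logResolvent, norm_inv]
    refine inv_anti₀ (by linarith) ?_
    have h3 := norm_sub_le_norm_add (exp (ρ * ((R : ℝ) + y * I))) (lam : ℂ)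
    rw [norm_exp, norm_real, Real.norm_of_nonneg hl.le] at h3
    simpa using h3
  have hne (y : ℝ) : exp ((R : ℝ) + y * I) - s ≠ 0 := by
    rw [← norm_pos_iff]; exact hpos.trans_le (hden y)
  have hb (y : ℝ) : ‖cauchyQuot ρ lam s ((R : ℝ) + y * I) + F₀‖ ≤ ε R := by
    have h5 : cauchyQuot ρ lam s ((R : ℝ) + y * I) + F₀ =
        (logResolvent ρ lam ((R : ℝ) + y * I) * exp ((R : ℝ) + y * I) - F₀ * s) /
          (exp ((R : ℝ) + y * I) - s) := by
      rw [cauchyQuot, ← hF₀, div_add' _ _ _ (hne y)]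
      ring
    have h6 : ε R = ((Real.exp (ρ * R) - lam)⁻¹ * Real.exp R + ‖F₀‖ * s) /
        (Real.exp R * (1 - s * Real.exp (-R))) := by
      have h7 : 1 - s * Real.exp (-R) ≠ 0 := by linarith
      simp only [ε]
      rw [div_eq_div_iff h7 hpos.ne']
      have h8 : Real.exp (-R) * Real.exp R = 1 := by rw [← Real.exp_add]; simp
      linear_combination (‖F₀‖ * s * (1 - s * Real.exp (-R))) * h8
    rw [h5, h6, norm_div]
    have h9 : (0 : ℝ) < Real.exp (ρ * R) - lam := by linarith
    refine div_le_div₀ (by positivity) ?_ hpos (hden y)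
    refine (norm_sub_le _ _).trans (add_le_add ?_ ?_)
    · rw [norm_mul, norm_exp]
      refine mul_le_mul (hF y) (by simp) (Real.exp_pos _).le (by positivity)
    · rw [norm_mul, norm_real, Real.norm_of_nonneg hs.le]
  have hcont : Continuous fun y : ℝ => logResolvent ρ lam ((R : ℝ) + y * I) := by
    refine Continuous.inv₀ (by fun_prop) fun y h => ?_
    have h3 := norm_sub_le_norm_add (exp (ρ * ((R : ℝ) + y * I))) (lam : ℂ)
    rw [norm_exp, norm_real, Real.norm_of_nonneg hl.le, h] at h3
    simp at h3
    linarith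
  have hcq : Continuous fun y : ℝ => cauchyQuot ρ lam s ((R : ℝ) + y * I) :=
    ((hcont.sub continuous_const).mul (by fun_prop)).div (by fun_prop) hne
  have h10 : (∫ y in (-Real.pi)..Real.pi, cauchyQuot ρ lam s ((R : ℝ) + y * I)) -
      -(2 * Real.pi * F₀) =
      ∫ y in (-Real.pi)..Real.pi, (cauchyQuot ρ lam s ((R : ℝ) + y * I) + F₀) := by
    rw [intervalIntegral.integral_add (hcq.intervalIntegrable _ _) (by simp),
      intervalIntegral.integral_const, real_smul]
    push_cast
    ring
  rw [h10]
  exact intervalIntegral.norm_integral_le_of_norm_le_const fun y _ => hb y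

/-- Far to the left the other factors stay bounded, and `e ^ w` makes the integrand vanish
uniformly. -/
lemma tendsto_vertical_left (hl : 0 < lam) (h0 : 0 < ρ) (hs : 0 < s) :
    Tendsto (fun R : ℝ => ∫ y in (-Real.pi)..Real.pi, cauchyQuot ρ lam s ((-R : ℝ) + y * I)) atTop
      (𝓝 0) := by
  set F₀ := logResolvent ρ lam (Real.log s : ℝ) with hF₀
  let ε : ℝ → ℝ := fun R =>
    ((lam - Real.exp (-(ρ * R)))⁻¹ + ‖F₀‖) * Real.exp (-R) / (s - Real.exp (-R))
  have hexp : Tendsto (fun R : ℝ => Real.exp (-R)) atTop (𝓝 0) :=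
    Real.tendsto_exp_neg_atTop_nhds_zero
  have hexp' : Tendsto (fun R : ℝ => Real.exp (-(ρ * R))) atTop (𝓝 0) :=
    hexp.comp (tendsto_id.const_mul_atTop h0)
  have hε : Tendsto ε atTop (𝓝 0) := by
    have h1 : Tendsto (fun R : ℝ => (lam - Real.exp (-(ρ * R)))⁻¹) atTop (𝓝 (lam - 0)⁻¹) :=
      (tendsto_const_nhds.sub hexp').inv₀ (by simpa using hl.ne')
    have h2 := ((h1.add_const ‖F₀‖).mul hexp).div (tendsto_const_nhds.sub hexp)
      (by simpa using hs.ne' : s - 0 ≠ 0)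
    simp only [mul_zero, zero_div] at h2
    exact h2
  rw [tendsto_zero_iff_norm_tendsto_zero]
  have hε' : Tendsto (fun R => ε R * |Real.pi - -Real.pi|) atTop (𝓝 0) := by
    simpa using hε.mul_const _
  refine squeeze_zero' (.of_forall fun _ => norm_nonneg _) ?_ hε'
  filter_upwards [hexp'.eventually_lt_const hl, hexp.eventually_lt_const hs] with R h1 h2
  refine intervalIntegral.norm_integral_le_of_norm_le_const fun y _ => ?_
  rw [cauchyQuot, norm_div, norm_mul]
  have h3 := norm_sub_norm_le (s : ℂ) (exp ((-R : ℝ) + y * I))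
  rw [norm_exp, norm_real, Real.norm_of_nonneg hs.le, norm_sub_rev] at h3
  have h4 := norm_sub_le_norm_add (lam : ℂ) (exp (ρ * ((-R : ℝ) + y * I)))
  rw [norm_exp, norm_real, Real.norm_of_nonneg hl.le, add_comm (lam : ℂ)] at h4
  have h5 : ‖logResolvent ρ lam ((-R : ℝ) + y * I)‖ ≤ (lam - Real.exp (-(ρ * R)))⁻¹ := by
    rw [logResolvent, norm_inv]
    exact inv_anti₀ (by linarith) (by simpa using h4)
  have h6 : (0 : ℝ) < lam - Real.exp (-(ρ * R)) := by linarith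
  refine div_le_div₀ (by positivity) ?_ (by linarith) (by simpa using h3)
  refine mul_le_mul ((norm_sub_le _ _).trans (add_le_add_left h5 _)) ?_ (norm_nonneg _)
    (by positivity)
  rw [norm_exp]
  simp

/-- The Stieltjes transform of `mlDensity` is `(s ^ ρ + lam)⁻¹`. -/
lemma integral_mlDensity_div (h0 : 0 < ρ) (h1 : ρ < 1) (hl : 0 < lam) (hs : 0 < s) :
    ∫ r in Ioi (0 : ℝ), mlDensity ρ lam r / (s + r) = (s ^ ρ + lam)⁻¹ := by
  have hk := (integral_exp_mul_laplace (powBound_mlDensity h0 h1 hl) (by linarith) (by linarith)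
    hs).2.1
  have hlim := (tendsto_intervalIntegral_comp_exp hk).ofReal
  have hr := tendsto_vertical_right hl h0 hs
  have hlft := tendsto_vertical_left hl h0 hs
  have hpi : (Real.pi : ℂ) ≠ 0 := by exact_mod_cast Real.pi_ne_zero
  have hlim2 : Tendsto (fun R : ℝ => (((∫ x in (-R)..R, Real.exp x *
      (mlDensity ρ lam (Real.exp x) / (s + Real.exp x)) : ℝ)) : ℂ)) atTop
      (𝓝 (logResolvent ρ lam (Real.log s : ℝ))) := by
    have h2 := ((hlft.sub hr).const_mul (2 * (Real.pi : ℂ))⁻¹)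
    have h3 : (2 * (Real.pi : ℂ))⁻¹ * (0 - -(2 * Real.pi * logResolvent ρ lam (Real.log s : ℝ))) =
        logResolvent ρ lam (Real.log s : ℝ) := by
      field_simp
      ring
    rw [h3] at h2
    refine h2.congr' ?_
    filter_upwards [eventually_gt_atTop |Real.log s|] with R hR
    have hrect := cauchyQuot_rect h0 h1 hl hs hR
    have hc (θ : ℝ) (hθ : |θ| ≤ Real.pi) (hθ0 : θ ≠ 0) :
        Continuous fun x : ℝ => cauchyQuot ρ lam s (x + (θ : ℝ) * I) := by
      refine Continuous.div (((Continuous.inv₀ (by fun_prop) fun x => ?_).sub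
        continuous_const).mul (by fun_prop)) (by fun_prop) fun x => ?_
      · refine exp_add_ne_zero h0 hl ?_
        simp only [add_im, ofReal_im, mul_im, ofReal_re, I_im, mul_one, I_re, mul_zero, add_zero,
          zero_add]
        exact lt_of_le_of_lt hθ (by rw [lt_div_iff₀ h0]; nlinarith [Real.pi_pos])
      · refine exp_sub_ne_zero hs (by simpa using hθ) fun h => ?_
        have := congrArg im h
        simp at this
        exact hθ0 this
    have hpi0 := Real.pi_pos
    rw [← intervalIntegral.integral_sub
      ((hc _ (by simp [abs_of_pos hpi0]) (by simp)).intervalIntegrable _ _)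
      ((hc _ (by simp [abs_of_pos hpi0]) (by simp)).intervalIntegrable _ _)] at hrect
    simp_rw [cauchyQuot_sub_cauchyQuot h0 h1 hl hs] at hrect
    rw [intervalIntegral.integral_const_mul, intervalIntegral.integral_ofReal] at hrect
    simp only [smul_eq_mul] at hrect
    rw [inv_mul_eq_div, div_eq_iff (by simp)]
    refine mul_left_cancel₀ I_ne_zero ?_
    linear_combination -hrect
  have := tendsto_nhds_unique hlim hlim2
  rw [logResolvent_log hs] at this
  exact_mod_cast this

end Stieltjes

/-! ### The Beta kernel. -/

section BetaKernel

/-- Each half of the interval contains only one of the two singularities, and the reflection `x ↦ t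
- x` exchanges the halves. -/
lemma intervalIntegrable_sub_rpow_mul_rpow {a b t : ℝ} (ha : -1 < a) (hb : -1 < b) (ht : 0 < t) :
    IntervalIntegrable (fun x => (t - x) ^ a * x ^ b) volume 0 t := by
  have hleft {a b : ℝ} (hb : -1 < b) :
      IntervalIntegrable (fun x => (t - x) ^ a * x ^ b) volume 0 (t / 2) := by
    refine (intervalIntegral.intervalIntegrable_rpow' hb).continuousOn_mul ?_
    refine ContinuousOn.rpow_const (by fun_prop) fun x hx => Or.inl ?_
    rw [uIcc_of_le (by positivity)] at hx
    linarith [hx.2]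
  have hright := (hleft (a := b) ha).comp_sub_left t
  simp only [sub_sub_cancel, sub_zero, sub_half] at hright
  refine (hleft hb).trans ((hright.symm.congr ?_))
  intro x _
  simp only [mul_comm]

lemma integral_sub_rpow_mul_rpow {a b t : ℝ} (ht : 0 < t) :
    ∫ x in (0 : ℝ)..t, (t - x) ^ a * x ^ b =
      t ^ (a + b + 1) * ∫ x in (0 : ℝ)..1, (1 - x) ^ a * x ^ b := by
  have h := intervalIntegral.smul_integral_comp_mul_left (a := 0) (b := 1)
    (fun x => (t - x) ^ a * x ^ b) t
  rw [mul_zero, mul_one] at h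
  rw [← h, Real.rpow_add_one ht.ne', Real.rpow_add ht, smul_eq_mul, mul_comm _ t, mul_assoc]
  congr 1
  rw [← intervalIntegral.integral_const_mul]
  refine intervalIntegral.integral_congr fun x hx => ?_
  rw [uIcc_of_le zero_le_one] at hx
  rw [show t - t * x = t * (1 - x) by ring, Real.mul_rpow ht.le (sub_nonneg.2 hx.2),
    Real.mul_rpow ht.le hx.1]
  ring

lemma integral_one_sub_rpow_mul_rpow_pos {a b : ℝ} (ha : -1 < a) (hb : -1 < b) :
    0 < ∫ x in (0 : ℝ)..1, (1 - x) ^ a * x ^ b :=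
  intervalIntegral.intervalIntegral_pos_of_pos_on
    (intervalIntegrable_sub_rpow_mul_rpow ha hb one_pos)
    (fun _ hx => mul_pos (Real.rpow_pos_of_pos (sub_pos.2 hx.2) a) (Real.rpow_pos_of_pos hx.1 b))
    one_pos

end BetaKernel

/-! ### Riemann-Liouville integrals: existence, continuity, Laplace transform. -/

section FractionalIntegral

variable {E : Type*} [NormedAddCommGroup E] [NormedSpace ℝ E] {ρ : ℝ}

lemma rlIntegrand_sub_one (ρ : ℝ) (h : ℝ → E) (t ξ : ℝ) :
    rlIntegrand (ρ - 1) h t ξ = (t - ξ) ^ (-ρ) • h ξ := by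
  rw [rlIntegrand, sub_add_cancel]

lemma rlIntegral_sub_one (ρ : ℝ) (h : ℝ → E) (t : ℝ) :
    rlIntegral (ρ - 1) h t =
      (Real.Gamma (1 - ρ))⁻¹ • ∫ ξ in (0 : ℝ)..t, (t - ξ) ^ (-ρ) • h ξ := by
  simp only [rlIntegral, rlIntegrand_sub_one, neg_sub]

lemma rlIntegrable_of_norm_le (h1 : ρ < 1) (h0 : 0 < ρ) {u : ℝ → E} {C : ℝ}
    (hc : ContinuousOn u (Ioi 0)) (hu : ∀ t, 0 < t → ‖u t‖ ≤ C * t ^ (ρ - 1)) {t : ℝ}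
    (ht : 0 < t) : RLIntegrable (ρ - 1) u t := by
  have hi := (intervalIntegrable_sub_rpow_mul_rpow (a := -ρ) (b := ρ - 1) (by linarith)
    (by linarith) ht).const_mul C
  rw [RLIntegrable]
  rw [intervalIntegrable_iff_integrableOn_Ioc_of_le ht.le] at hi ⊢
  have hm : AEStronglyMeasurable u (volume.restrict (Ioc 0 t)) :=
    (hc.mono fun x hx => hx.1).aestronglyMeasurable measurableSet_Ioc
  refine Integrable.mono' hi ?_ ((ae_restrict_iff' measurableSet_Ioc).2 (.of_forall fun x hx => ?_))
  · exact (by fun_prop : Measurable fun x : ℝ => (t - x) ^ (-(ρ - 1 + 1))).aestronglyMeasurable.smul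
      hm
  · rw [rlIntegrand_sub_one, norm_smul,
      Real.norm_of_nonneg (Real.rpow_nonneg (sub_nonneg.2 hx.2) _)]
    have := mul_le_mul_of_nonneg_left (hu x hx.1)
      (Real.rpow_nonneg (sub_nonneg.2 hx.2) (-ρ))
    linarith

/-- The substitution `ξ = t x` fixes the interval of integration, and a multiple of `(1 - x) ^ (-ρ)
* x ^ (ρ - 1)` dominates the integrand for all `t` near `t₀`. -/
lemma continuousOn_rlIntegral (h1 : ρ < 1) (h0 : 0 < ρ) {u : ℝ → E} {C : ℝ} (hC : 0 ≤ C)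
    (hc : ContinuousOn u (Ioi 0)) (hu : ∀ t, 0 < t → ‖u t‖ ≤ C * t ^ (ρ - 1)) :
    ContinuousOn (rlIntegral (ρ - 1) u) (Ioi 0) := by
  have heq : EqOn (rlIntegral (ρ - 1) u) (fun t => (Real.Gamma (1 - ρ))⁻¹ •
      (t • ∫ x in (0 : ℝ)..1, (t - t * x) ^ (-ρ) • u (t * x))) (Ioi 0) := by
    intro t _
    have h := intervalIntegral.smul_integral_comp_mul_left (a := 0) (b := 1)
      (fun x => (t - x) ^ (-ρ) • u x) t
    rw [mul_zero, mul_one] at h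
    rw [rlIntegral_sub_one, ← h]
  refine ContinuousOn.congr (fun t₀ (ht₀ : 0 < t₀) => ContinuousAt.continuousWithinAt ?_) heq
  refine continuousAt_const.smul (continuousAt_id.smul ?_)
  have hnear : ∀ᶠ t in 𝓝 t₀, t₀ / 2 < t := lt_mem_nhds (half_lt_self ht₀)
  have hb : IntervalIntegrable (fun x : ℝ => (t₀ / 2) ^ (-ρ) * (C * (t₀ / 2) ^ (ρ - 1)) *
      ((1 - x) ^ (-ρ) * x ^ (ρ - 1))) volume 0 1 :=
    (intervalIntegrable_sub_rpow_mul_rpow (by linarith) (by linarith) one_pos).const_mul _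
  refine intervalIntegral.continuousAt_of_dominated_interval ?_ ?_ hb ?_
  · filter_upwards [hnear] with t ht
    have ht0 : 0 < t := (half_pos ht₀).trans ht
    rw [uIoc_of_le zero_le_one]
    refine (by fun_prop : Measurable fun x : ℝ => (t - t * x) ^ (-ρ)).aestronglyMeasurable.smul ?_
    refine ContinuousOn.aestronglyMeasurable ?_ measurableSet_Ioc
    exact hc.comp (by fun_prop) fun x hx => mul_pos ht0 hx.1
  · filter_upwards [hnear] with t ht
    have ht0 : 0 < t := (half_pos ht₀).trans ht
    refine .of_forall fun x hx => ?_
    rw [uIoc_of_le zero_le_one] at hx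
    have h1x : 0 ≤ 1 - x := sub_nonneg.2 hx.2
    rw [norm_smul, show t - t * x = t * (1 - x) by ring, Real.mul_rpow ht0.le h1x,
      Real.norm_of_nonneg (mul_nonneg (Real.rpow_nonneg ht0.le _) (Real.rpow_nonneg h1x _))]
    have h3 : t ^ (-ρ) ≤ (t₀ / 2) ^ (-ρ) :=
      Real.rpow_le_rpow_of_nonpos (half_pos ht₀) ht.le (by linarith)
    have h4 : ‖u (t * x)‖ ≤ C * (t₀ / 2) ^ (ρ - 1) * x ^ (ρ - 1) := by
      refine (hu _ (mul_pos ht0 hx.1)).trans ?_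
      rw [Real.mul_rpow ht0.le hx.1.le, mul_assoc]
      refine mul_le_mul_of_nonneg_left (mul_le_mul_of_nonneg_right ?_
        (Real.rpow_nonneg hx.1.le _)) hC
      exact Real.rpow_le_rpow_of_nonpos (half_pos ht₀) ht.le (by linarith)
    calc t ^ (-ρ) * (1 - x) ^ (-ρ) * ‖u (t * x)‖
        ≤ (t₀ / 2) ^ (-ρ) * (1 - x) ^ (-ρ) * (C * (t₀ / 2) ^ (ρ - 1) * x ^ (ρ - 1)) := by
          refine mul_le_mul (mul_le_mul_of_nonneg_right h3 (Real.rpow_nonneg h1x _)) h4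
            (norm_nonneg _) ?_
          exact mul_nonneg (Real.rpow_nonneg (half_pos ht₀).le _) (Real.rpow_nonneg h1x _)
      _ = _ := by ring
  · have hne : ∀ᵐ x : ℝ, x ≠ 1 := by simp [ae_iff]
    filter_upwards [hne] with x hx1 hx
    rw [uIoc_of_le zero_le_one] at hx
    have hlt : x < 1 := lt_of_le_of_ne hx.2 hx1
    refine ContinuousAt.smul (ContinuousAt.rpow_const (by fun_prop) (Or.inl ?_)) ?_
    · nlinarith
    · exact ContinuousAt.comp (g := u) (f := fun t => t * x)
        (hc.continuousAt (Ioi_mem_nhds (mul_pos ht₀ hx.1))) (by fun_prop)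

/-- The Laplace transform of a fractional integral. -/
lemma integral_exp_mul_rlIntegral (h1 : ρ < 1) {u : ℝ → ℝ} {s : ℝ} (hs : 0 < s)
    (hu : IntegrableOn (fun t => Real.exp (-(t * s)) * u t) (Ioi 0)) :
    IntegrableOn (fun t => Real.exp (-(t * s)) * rlIntegral (ρ - 1) u t) (Ioi 0) ∧
    ∫ t in Ioi (0 : ℝ), Real.exp (-(t * s)) * rlIntegral (ρ - 1) u t =
      s ^ (ρ - 1) * ∫ t in Ioi (0 : ℝ), Real.exp (-(t * s)) * u t := by
  have hk := integrableOn_exp_mul_rpow (a := -ρ) (by linarith) hs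
  -- Since `e ^ (-xs) = e ^ (-ξs) e ^ (-(x - ξ)s)`, the weighted fractional integral is, up to `Γ(1
  -- - ρ)`, the convolution of two weighted integrable functions.
  have hconv (x : ℝ) : ∫ ξ in (0 : ℝ)..x, ContinuousLinearMap.mul ℝ ℝ (Real.exp (-(ξ * s)) * u ξ)
      (Real.exp (-((x - ξ) * s)) * (x - ξ) ^ (-ρ)) =
      Real.Gamma (1 - ρ) * (Real.exp (-(x * s)) * rlIntegral (ρ - 1) u x) := by
    have hG : Real.Gamma (1 - ρ) ≠ 0 := (Real.Gamma_pos_of_pos (by linarith)).ne'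
    rw [rlIntegral_sub_one, mul_left_comm, smul_eq_mul, mul_inv_cancel_left₀ hG,
      ← intervalIntegral.integral_const_mul]
    refine intervalIntegral.integral_congr fun ξ _ => ?_
    simp only [ContinuousLinearMap.mul_apply', smul_eq_mul]
    have : Real.exp (-(x * s)) = Real.exp (-(ξ * s)) * Real.exp (-((x - ξ) * s)) := by
      rw [← Real.exp_add]; ring_nf
    rw [this]
    ring
  have hG : Real.Gamma (1 - ρ) ≠ 0 := (Real.Gamma_pos_of_pos (by linarith)).ne'
  constructor
  · have h := integrable_posConvolution (μ := volume) (ν := volume) hu hk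
      (ContinuousLinearMap.mul ℝ ℝ)
    simp only [posConvolution, hconv] at h
    rw [integrable_indicator_iff measurableSet_Ioi] at h
    exact (integrable_const_mul_iff hG.isUnit _).1 h
  · have h := integral_posConvolution (μ := volume) (ν := volume) hu hk
      (ContinuousLinearMap.mul ℝ ℝ)
    simp only [hconv] at h
    rw [integral_const_mul, integral_exp_mul_rpow (by linarith) hs,
      ContinuousLinearMap.mul_apply', neg_add_eq_sub, neg_sub] at h
    refine mul_left_cancel₀ hG ?_
    rw [h]
    ring

end FractionalIntegral

/-! ### The scalar solution and its fractional integral. -/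

section MittagLeffler

variable {ρ lam : ℝ}

/-- The bound `r ^ (ρ - 1)` settles only the origin. For `r > 1`, `1 / r ≤ 2 / (1 + r)` reduces the
claim to convergence of the Stieltjes transform at `s = 1`. -/
lemma integrableOn_mul_mlDensity_div (h0 : 0 < ρ) (h1 : ρ < 1) (hl : 0 < lam) :
    IntegrableOn (fun r => lam * mlDensity ρ lam r / r) (Ioi 0) := by
  have hp := powBound_mul_mlDensity_div h0 h1 hl
  have hm : Measurable fun r => lam * mlDensity ρ lam r / r :=
    (measurable_mlDensity.const_mul lam).div measurable_id
  rw [← Ioc_union_Ioi_eq_Ioi zero_le_one]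
  refine IntegrableOn.union ?_ ?_
  · have hi : IntegrableOn (fun r : ℝ => mlConst ρ / lam * r ^ (ρ - 1)) (Ioc 0 1) := by
      have := (intervalIntegral.intervalIntegrable_rpow' (a := 0) (b := 1) (r := ρ - 1)
        (by linarith)).const_mul (mlConst ρ / lam)
      rwa [intervalIntegrable_iff_integrableOn_Ioc_of_le zero_le_one] at this
    exact Integrable.mono' hi hm.aestronglyMeasurable
      ((ae_restrict_iff' measurableSet_Ioc).2 (.of_forall fun r hr => hp.le r hr.1))
  · have hi := (integral_exp_mul_laplace (powBound_mlDensity h0 h1 hl) (by linarith) (by linarith)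
      one_pos).2.1
    refine Integrable.mono' ((hi.mono_set (Ioi_subset_Ioi zero_le_one)).const_mul (2 * lam))
      hm.aestronglyMeasurable
      ((ae_restrict_iff' measurableSet_Ioi).2 (.of_forall fun r (hr : 1 < r) => ?_))
    have hr0 : 0 < r := by linarith
    have hK := mlDensity_nonneg h0 h1 hl hr0
    rw [Real.norm_of_nonneg (by positivity), mul_div_assoc', div_le_div_iff₀ hr0 (by positivity)]
    have h3 : 0 ≤ lam * mlDensity ρ lam r := by positivity
    nlinarith

/-- Limit `s → 0+` of `lam` times the Stieltjes transform. The mass one is the value at `t = 0+` of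
the fractional integral of the scalar solution. -/
lemma integral_mul_mlDensity_div (h0 : 0 < ρ) (h1 : ρ < 1) (hl : 0 < lam) :
    ∫ r in Ioi (0 : ℝ), lam * mlDensity ρ lam r / r = 1 := by
  have hlim1 : Tendsto (fun s : ℝ => ∫ r in Ioi (0 : ℝ), lam * mlDensity ρ lam r / (s + r))
      (𝓝[>] 0) (𝓝 (∫ r in Ioi (0 : ℝ), lam * mlDensity ρ lam r / r)) := by
    refine tendsto_integral_filter_of_dominated_convergence
      (fun r => lam * mlDensity ρ lam r / r) (.of_forall fun s => ?_) ?_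
      (integrableOn_mul_mlDensity_div h0 h1 hl) ?_
    · exact ((measurable_mlDensity.const_mul lam).div
        (measurable_id.const_add s)).aestronglyMeasurable
    · filter_upwards [self_mem_nhdsWithin] with s (hs : 0 < s)
      refine (ae_restrict_iff' measurableSet_Ioi).2 (.of_forall fun r (hr : 0 < r) => ?_)
      have hK := mlDensity_nonneg h0 h1 hl hr
      rw [Real.norm_of_nonneg (by positivity)]
      exact div_le_div_of_nonneg_left (by positivity) hr (by linarith)
    · refine (ae_restrict_iff' measurableSet_Ioi).2 (.of_forall fun r (hr : 0 < r) => ?_)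
      refine Tendsto.mono_left ?_ nhdsWithin_le_nhds
      have : ContinuousAt (fun s : ℝ => lam * mlDensity ρ lam r / (s + r)) 0 :=
        ContinuousAt.div (by fun_prop) (by fun_prop) (by simpa using hr.ne')
      simpa using this.tendsto
  have hlim2 : Tendsto (fun s : ℝ => lam * (s ^ ρ + lam)⁻¹) (𝓝[>] 0) (𝓝 1) := by
    have : ContinuousAt (fun s : ℝ => lam * (s ^ ρ + lam)⁻¹) 0 := by
      refine continuousAt_const.mul (ContinuousAt.inv₀
        ((Real.continuousAt_rpow_const 0 ρ (Or.inr h0.le)).add_const lam) ?_)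
      simpa [Real.zero_rpow h0.ne'] using hl.ne'
    have h2 := this.tendsto.mono_left (nhdsWithin_le_nhds (s := Ioi 0))
    simpa [Real.zero_rpow h0.ne', hl.ne'] using h2
  refine tendsto_nhds_unique hlim1 (hlim2.congr' ?_)
  filter_upwards [self_mem_nhdsWithin] with s (hs : 0 < s)
  simp_rw [mul_div_assoc]
  rw [integral_const_mul, integral_mlDensity_div h0 h1 hl hs]

lemma laplace_mlDensity_nonneg (h0 : 0 < ρ) (h1 : ρ < 1) (hl : 0 < lam) (t : ℝ) :
    0 ≤ laplace (mlDensity ρ lam) t :=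
  setIntegral_nonneg measurableSet_Ioi fun _ hr =>
    mul_nonneg (Real.exp_pos _).le (mlDensity_nonneg h0 h1 hl hr)

lemma laplace_mul_mlDensity_div_mem (h0 : 0 < ρ) (h1 : ρ < 1) (hl : 0 < lam) {t : ℝ} (ht : 0 < t) :
    laplace (fun r => lam * mlDensity ρ lam r / r) t ∈ Icc (0 : ℝ) 1 := by
  have hnn : ∀ r : ℝ, 0 < r → 0 ≤ lam * mlDensity ρ lam r / r := fun r hr =>
    div_nonneg (mul_nonneg hl.le (mlDensity_nonneg h0 h1 hl hr)) hr.le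
  constructor
  · exact setIntegral_nonneg measurableSet_Ioi fun r hr =>
      mul_nonneg (Real.exp_pos _).le (hnn r hr)
  · rw [← integral_mul_mlDensity_div h0 h1 hl]
    refine setIntegral_mono_on ((powBound_mul_mlDensity_div h0 h1 hl).integrableOn (by linarith) ht)
      (integrableOn_mul_mlDensity_div h0 h1 hl) measurableSet_Ioi fun r (hr : 0 < r) => ?_
    refine mul_le_of_le_one_left (hnn r hr) (Real.exp_le_one_iff.2 ?_)
    have := mul_pos hr ht
    linarith

lemma tendsto_laplace_mul_mlDensity_div (h0 : 0 < ρ) (h1 : ρ < 1) (hl : 0 < lam) :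
    Tendsto (laplace fun r => lam * mlDensity ρ lam r / r) (𝓝[>] 0) (𝓝 1) := by
  rw [← integral_mul_mlDensity_div h0 h1 hl]
  have hp := powBound_mul_mlDensity_div h0 h1 hl
  refine tendsto_integral_filter_of_dominated_convergence
    (fun r => lam * mlDensity ρ lam r / r) (.of_forall fun s => hp.aesm_exp s) ?_
    (integrableOn_mul_mlDensity_div h0 h1 hl) ?_
  · filter_upwards [self_mem_nhdsWithin] with t (ht : 0 < t)
    refine (ae_restrict_iff' measurableSet_Ioi).2 (.of_forall fun r (hr : 0 < r) => ?_)
    have hK := mlDensity_nonneg h0 h1 hl hr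
    have := mul_pos hr ht
    rw [norm_smul, Real.norm_of_nonneg (Real.exp_pos _).le, Real.norm_of_nonneg (by positivity)]
    exact mul_le_of_le_one_left (by positivity) (Real.exp_le_one_iff.2 (by linarith))
  · refine .of_forall fun r => Tendsto.mono_left ?_ nhdsWithin_le_nhds
    have : Continuous fun t : ℝ => Real.exp (-(r * t)) • (lam * mlDensity ρ lam r / r) := by fun_prop
    simpa using this.tendsto 0

/-- The partial fractions `1 / (r(s + r)) = s⁻¹ (1 / r - 1 / (s + r))` leave the total mass minus
`lam` times the Stieltjes transform. -/
lemma integral_exp_mul_laplace_mul_mlDensity_div (h0 : 0 < ρ) (h1 : ρ < 1) (hl : 0 < lam) {s : ℝ}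
    (hs : 0 < s) :
    ∫ t in Ioi (0 : ℝ), Real.exp (-(t * s)) * laplace (fun r => lam * mlDensity ρ lam r / r) t =
      s ^ (ρ - 1) * (s ^ ρ + lam)⁻¹ := by
  rw [(integral_exp_mul_laplace (powBound_mul_mlDensity_div h0 h1 hl) (by linarith) (by linarith)
    hs).2.2]
  have hi := (integral_exp_mul_laplace (powBound_mlDensity h0 h1 hl) (by linarith) (by linarith)
    hs).2.1
  have : ∀ r ∈ Ioi (0 : ℝ), lam * mlDensity ρ lam r / r / (s + r) =
      s⁻¹ * (lam * mlDensity ρ lam r / r - lam * (mlDensity ρ lam r / (s + r))) := by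
    intro r (hr : 0 < r)
    have : s + r ≠ 0 := by positivity
    field_simp
    ring
  rw [setIntegral_congr_fun measurableSet_Ioi this, integral_const_mul,
    integral_sub (integrableOn_mul_mlDensity_div h0 h1 hl) (hi.const_mul lam), integral_const_mul,
    integral_mul_mlDensity_div h0 h1 hl, integral_mlDensity_div h0 h1 hl hs,
    Real.rpow_sub_one hs.ne']
  have : 0 < s ^ ρ + lam := by positivity
  field_simp
  ring

/-- The fractional integral of order `1 - ρ` of the Laplace transform of `mlDensity`. -/
lemma rlIntegral_laplace_mlDensity (h0 : 0 < ρ) (h1 : ρ < 1) (hl : 0 < lam) :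
    EqOn (rlIntegral (ρ - 1) (laplace (mlDensity ρ lam)))
      (laplace fun r => lam * mlDensity ρ lam r / r) (Ioi 0) := by
  have hp := powBound_mlDensity h0 h1 hl
  have hq := powBound_mul_mlDensity_div h0 h1 hl
  have hG : 0 < Real.Gamma (1 - ρ) := Real.Gamma_pos_of_pos (by linarith)
  have hbound : ∀ t, 0 < t → ‖laplace (mlDensity ρ lam) t‖ ≤
      mlConst ρ * Real.Gamma (-ρ + 1) * t ^ (ρ - 1) := fun t ht => by
    have := hp.norm_laplace_le (by linarith) ht
    rwa [neg_add, neg_neg, ← sub_eq_add_neg] at this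
  have hrl (s : ℝ) (hs : 0 < s) := integral_exp_mul_rlIntegral h1 hs
    (integral_exp_mul_laplace hp (by linarith) (by linarith) hs).1
  -- Both sides are nonnegative, because the density is, and both have transform `s ^ (ρ - 1) / (s ^
  -- ρ + lam)`.
  refine eqOn_of_laplace_eq ?_ (hq.continuousOn_laplace (by linarith)) ?_
    (fun t ht => (laplace_mul_mlDensity_div_mem h0 h1 hl ht).1) (fun s hs => (hrl s hs).1)
    (fun s hs => (integral_exp_mul_laplace hq (by linarith) (by linarith) hs).1) fun s hs => ?_
  · refine continuousOn_rlIntegral h1 h0 ?_ (hp.continuousOn_laplace (by linarith)) hbound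
    rw [neg_add_eq_sub]
    exact mul_nonneg hp.nonneg hG.le
  · intro t ht
    rw [rlIntegral_sub_one]
    refine mul_nonneg (inv_nonneg.2 hG.le) (intervalIntegral.integral_nonneg ht.le fun x hx => ?_)
    exact mul_nonneg (Real.rpow_nonneg (sub_nonneg.2 hx.2) _) (laplace_mlDensity_nonneg h0 h1 hl x)
  · rw [(hrl s hs).2, integral_exp_mul_laplace_mul_mlDensity_div h0 h1 hl hs,
      (integral_exp_mul_laplace hp (by linarith) (by linarith) hs).2.2,
      integral_mlDensity_div h0 h1 hl hs]

end MittagLeffler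

/-! ### Uniqueness for the scalar equation through a Volterra inequality. -/

section Volterra

variable {E : Type*} [NormedAddCommGroup E] [NormedSpace ℝ E] {ρ : ℝ}

/-- Multiplying by the continuous factor `(t - ξ) ^ ρ` removes the kernel away from the endpoint. -/
lemma RLIntegrable.intervalIntegrable {d : ℝ → E} {t : ℝ} (h0 : 0 < ρ) (ht : 0 < t)
    (h : RLIntegrable (ρ - 1) d t) : IntervalIntegrable d volume 0 t := by
  have h2 : IntervalIntegrable (fun ξ => (t - ξ) ^ ρ • rlIntegrand (ρ - 1) d t ξ) volume 0 t :=
    h.continuousOn_smul (ContinuousOn.rpow_const (by fun_prop) fun _ _ => Or.inr h0.le)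
  rw [intervalIntegrable_iff_integrableOn_Ioo_of_le ht.le] at h2 ⊢
  refine h2.congr_fun (fun ξ hξ => ?_) measurableSet_Ioo
  have : 0 < t - ξ := sub_pos.2 hξ.2
  simp only [rlIntegrand_sub_one]
  rw [smul_smul, ← Real.rpow_add this, add_neg_cancel, Real.rpow_zero, one_smul]

/-- Up to a constant, fractional integrals of orders `ρ` and `1 - ρ` compose to the primitive. -/
lemma integral_rpow_smul_integral_rpow_smul [CompleteSpace E] (h0 : 0 < ρ) (h1 : ρ < 1)
    {d : ℝ → E} {t : ℝ}
    (ht : 0 < t) (hd : IntervalIntegrable d volume 0 t) :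
    ∫ s in (0 : ℝ)..t, (t - s) ^ (ρ - 1) • ∫ ξ in (0 : ℝ)..s, (s - ξ) ^ (-ρ) • d ξ =
      (∫ x in (0 : ℝ)..1, (1 - x) ^ (ρ - 1) * x ^ (-ρ)) • ∫ ξ in (0 : ℝ)..t, d ξ := by
  set B := ∫ x in (0 : ℝ)..1, (1 - x) ^ (ρ - 1) * x ^ (-ρ) with hB
  -- The kernel is extended by zero off the triangle `ξ < s`, so that Fubini applies on a square.
  let k : ℝ → ℝ → ℝ := fun s ξ => if ξ < s then (t - s) ^ (ρ - 1) * (s - ξ) ^ (-ρ) else 0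
  have hkm : Measurable (fun p : ℝ × ℝ => k p.1 p.2) :=
    Measurable.ite (measurableSet_lt measurable_snd measurable_fst) (by fun_prop) measurable_const
  have hk0 : ∀ s ∈ Ioc 0 t, ∀ ξ, 0 ≤ k s ξ := fun s hs ξ => by
    simp only [k]
    split_ifs with h
    · exact mul_nonneg (Real.rpow_nonneg (sub_nonneg.2 hs.2) _)
        (Real.rpow_nonneg (sub_nonneg.2 h.le) _)
    · exact le_rfl
  have hind (ξ : ℝ) : (fun s => k s ξ) =
      (Ioi ξ).indicator fun s => (t - s) ^ (ρ - 1) * (s - ξ) ^ (-ρ) := rfl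
  -- The exponents add up to `-1`, so by scaling the inner integral does not depend on `ξ` or `t`.
  have hshift (ξ : ℝ) (hξ : ξ < t) :
      IntervalIntegrable (fun s => (t - s) ^ (ρ - 1) * (s - ξ) ^ (-ρ)) volume ξ t ∧
      ∫ s in ξ..t, (t - s) ^ (ρ - 1) * (s - ξ) ^ (-ρ) = B := by
    have h2 := (intervalIntegrable_sub_rpow_mul_rpow (a := ρ - 1) (b := -ρ) (by linarith)
      (by linarith) (sub_pos.2 hξ)).comp_sub_right ξ
    simp only [zero_add, sub_add_cancel, sub_sub_sub_cancel_right] at h2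
    refine ⟨h2, ?_⟩
    have h3 := intervalIntegral.integral_comp_sub_right
      (fun x => (t - ξ - x) ^ (ρ - 1) * x ^ (-ρ)) ξ (a := ξ) (b := t)
    simp only [sub_self, sub_sub_sub_cancel_right] at h3
    rw [h3, integral_sub_rpow_mul_rpow (sub_pos.2 hξ)]
    rw [show ρ - 1 + -ρ + 1 = 0 by ring, Real.rpow_zero, one_mul]
  have hinter (ξ : ℝ) (hξ : 0 < ξ) : Ioc 0 t ∩ Ioi ξ = Ioc ξ t := by
    ext x; simp only [mem_inter_iff, mem_Ioc, mem_Ioi]; constructor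
    · rintro ⟨⟨_, h2⟩, h3⟩; exact ⟨h3, h2⟩
    · rintro ⟨h3, h2⟩; exact ⟨⟨hξ.trans h3, h2⟩, h3⟩
  have hks (ξ : ℝ) (hξ : ξ ∈ Ioo 0 t) : IntegrableOn (fun s => k s ξ) (Ioc 0 t) ∧
      ∫ s in Ioc 0 t, k s ξ = B := by
    have h2 := hshift ξ hξ.2
    rw [intervalIntegrable_iff_integrableOn_Ioc_of_le hξ.2.le,
      intervalIntegral.integral_of_le hξ.2.le] at h2
    rw [hind, IntegrableOn, integrable_indicator_iff measurableSet_Ioi, IntegrableOn,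
      Measure.restrict_restrict measurableSet_Ioi, inter_comm, hinter ξ hξ.1,
      setIntegral_indicator measurableSet_Ioi, hinter ξ hξ.1]
    exact h2
  have hae : ∀ᵐ ξ ∂(volume.restrict (Ioc 0 t)), ξ ∈ Ioo 0 t := by
    rw [← restrict_Ioo_eq_restrict_Ioc]
    exact ae_restrict_mem measurableSet_Ioo
  rw [intervalIntegrable_iff_integrableOn_Ioc_of_le ht.le] at hd
  have hm : AEStronglyMeasurable (fun p : ℝ × ℝ => k p.1 p.2 • d p.2)
      ((volume.restrict (Ioc 0 t)).prod (volume.restrict (Ioc 0 t))) :=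
    hkm.aestronglyMeasurable.smul hd.1.comp_snd
  have hint : Integrable (fun p : ℝ × ℝ => k p.1 p.2 • d p.2)
      ((volume.restrict (Ioc 0 t)).prod (volume.restrict (Ioc 0 t))) := by
    rw [integrable_prod_iff' hm]
    constructor
    · filter_upwards [hae] with ξ hξ
      exact (hks ξ hξ).1.smul_const (d ξ)
    · refine (hd.norm.const_mul B).congr ?_
      filter_upwards [hae] with ξ hξ
      rw [← (hks ξ hξ).2, ← integral_mul_const]
      refine setIntegral_congr_fun measurableSet_Ioc fun s hs => ?_
      simp only [norm_smul, Real.norm_of_nonneg (hk0 s hs ξ)]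
  have hswap := integral_integral_swap (f := fun s ξ => k s ξ • d ξ) hint
  rw [intervalIntegral.integral_of_le ht.le, intervalIntegral.integral_of_le ht.le,
    ← integral_smul]
  refine Eq.trans ?_ (hswap.trans (integral_congr_ae ?_))
  · refine setIntegral_congr_fun measurableSet_Ioc fun s hs => ?_
    have h2 : (fun ξ => k s ξ • d ξ) =
        (Iio s).indicator fun ξ => (t - s) ^ (ρ - 1) • (s - ξ) ^ (-ρ) • d ξ := by
      funext ξ
      simp only [k, indicator, mem_Iio, smul_smul]
      split_ifs <;> simp
    have h3 : Ioc 0 t ∩ Iio s = Ioo 0 s := by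
      ext x; simp only [mem_inter_iff, mem_Ioc, mem_Iio, mem_Ioo]; constructor
      · rintro ⟨⟨h4, _⟩, h5⟩; exact ⟨h4, h5⟩
      · rintro ⟨h4, h5⟩; exact ⟨⟨h4, h5.le.trans hs.2⟩, h5⟩
    simp only [h2]
    rw [setIntegral_indicator measurableSet_Iio, h3, integral_smul,
      intervalIntegral.integral_of_le hs.1.le, integral_Ioc_eq_integral_Ioo]
  · filter_upwards [hae] with ξ hξ
    rw [integral_smul_const, (hks ξ hξ).2]

/-- `Γ(ρ) M ^ (-ρ)` is the integral of `x ^ (ρ - 1) e ^ (-Mx)` over the half-line: a large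
exponential weight turns the Volterra operator into a contraction. -/
lemma exists_exp_weight_small (h0 : 0 < ρ) (c : ℝ) : ∃ M : ℝ, 0 < M ∧
    c * (Real.Gamma ρ * M ^ (-ρ)) < 1 := by
  have h : Tendsto (fun M : ℝ => c * (Real.Gamma ρ * M ^ (-ρ))) atTop
      (𝓝 (c * (Real.Gamma ρ * 0))) :=
    ((tendsto_rpow_neg_atTop h0).const_mul _).const_mul _
  rw [mul_zero, mul_zero] at h
  obtain ⟨M, hM, hM0⟩ := ((h.eventually_lt_const one_pos).and (eventually_gt_atTop 0)).exists
  exact ⟨M, hM0, hM⟩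

/-- A homogeneous Volterra inequality with weakly singular kernel has only the zero solution. -/
lemma eq_zero_of_volterra {F : Type*} [NormedAddCommGroup F] (h0 : 0 < ρ) {c T : ℝ} (hc : 0 ≤ c)
    {W : ℝ → F}
    (hT : 0 ≤ T) (hW : ContinuousOn W (Icc 0 T))
    (h : ∀ t ∈ Icc 0 T, ‖W t‖ ≤ c * ∫ s in (0 : ℝ)..t, (t - s) ^ (ρ - 1) * ‖W s‖) :
    ∀ t ∈ Icc 0 T, W t = 0 := by
  obtain ⟨M, hM, hMc⟩ := exists_exp_weight_small h0 c
  -- At a maximum point of the weighted norm the inequality reads `N ≤ q N` with `q < 1`, so `N =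
  -- 0`.
  obtain ⟨τ, hτ, hmax⟩ := isCompact_Icc.exists_isMaxOn (nonempty_Icc.2 hT)
    (f := fun t => Real.exp (-(M * t)) * ‖W t‖)
    ((by fun_prop : Continuous fun t : ℝ => Real.exp (-(M * t))).continuousOn.mul hW.norm)
  set N := Real.exp (-(M * τ)) * ‖W τ‖ with hN
  have hN0 : 0 ≤ N := by positivity
  have hle : ∀ s ∈ Icc 0 T, ‖W s‖ ≤ N * Real.exp (M * s) := fun s hs => by
    have h2 : Real.exp (-(M * s)) * ‖W s‖ ≤ N := hmax hs
    have h3 := mul_le_mul_of_nonneg_right h2 (Real.exp_pos (M * s)).le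
    rwa [mul_right_comm, ← Real.exp_add, neg_add_cancel, Real.exp_zero, one_mul] at h3
  have hker := integrableOn_exp_mul_rpow (a := ρ - 1) (by linarith) hM
  have hint : ∫ s in (0 : ℝ)..τ, (τ - s) ^ (ρ - 1) * ‖W s‖ ≤
      N * Real.exp (M * τ) * (Real.Gamma ρ * M ^ (-ρ)) := by
    have hk : ∫ s in (0 : ℝ)..τ, Real.exp (-((τ - s) * M)) * (τ - s) ^ (ρ - 1) ≤
        Real.Gamma ρ * M ^ (-ρ) := by
      rw [intervalIntegral.integral_comp_sub_left
        (fun x => Real.exp (-(x * M)) * x ^ (ρ - 1)) τ, sub_self, sub_zero,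
        intervalIntegral.integral_of_le hτ.1]
      have h2 := integral_exp_mul_rpow (a := ρ - 1) (by linarith) hM
      rw [sub_add_cancel] at h2
      rw [← h2]
      refine setIntegral_mono_set hker ?_ (Ioc_subset_Ioi_self.eventuallyLE)
      exact (ae_restrict_iff' measurableSet_Ioi).2 (.of_forall fun x (hx : 0 < x) => by
        simp only [Pi.zero_apply]; positivity)
    have hkint : IntervalIntegrable
        (fun s => Real.exp (-((τ - s) * M)) * (τ - s) ^ (ρ - 1)) volume 0 τ := by
      have h2 := (intervalIntegrable_iff_integrableOn_Ioc_of_le hτ.1).2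
        (hker.mono_set Ioc_subset_Ioi_self)
      have h3 := (h2.comp_sub_left τ).symm
      simpa using h3
    have hrp : IntervalIntegrable (fun s => (τ - s) ^ (ρ - 1)) volume 0 τ := by
      have h2 := ((intervalIntegral.intervalIntegrable_rpow' (a := 0) (b := τ) (r := ρ - 1)
        (by linarith)).comp_sub_left τ).symm
      simpa using h2
    refine le_trans ?_ (mul_le_mul_of_nonneg_left hk (by positivity : 0 ≤ N * Real.exp (M * τ)))
    rw [← intervalIntegral.integral_const_mul]
    refine intervalIntegral.integral_mono_on hτ.1 ?_ (hkint.const_mul _) fun s hs => ?_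
    · refine hrp.mul_continuousOn (hW.norm.mono ?_)
      rw [uIcc_of_le hτ.1]
      exact Icc_subset_Icc_right hτ.2
    · have h2 := mul_le_mul_of_nonneg_left (hle s ⟨hs.1, hs.2.trans hτ.2⟩)
        (Real.rpow_nonneg (sub_nonneg.2 hs.2) (ρ - 1))
      refine h2.trans (le_of_eq ?_)
      have h3 : Real.exp (M * s) = Real.exp (M * τ) * Real.exp (-((τ - s) * M)) := by
        rw [← Real.exp_add]; ring_nf
      rw [h3]
      ring
  have hNle : N ≤ N * (c * (Real.Gamma ρ * M ^ (-ρ))) := by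
    have h2 := (h τ hτ).trans (mul_le_mul_of_nonneg_left hint hc)
    have h3 := mul_le_mul_of_nonneg_left h2 (Real.exp_pos (-(M * τ))).le
    refine h3.trans (le_of_eq ?_)
    have h4 : Real.exp (-(M * τ)) * Real.exp (M * τ) = 1 := by rw [← Real.exp_add]; simp
    linear_combination (N * c * (Real.Gamma ρ * M ^ (-ρ))) * h4
  have hNz : N = 0 := by nlinarith
  intro t ht
  have := hle t ht
  rw [hNz, zero_mul] at this
  exact norm_le_zero_iff.1 this

/-- Uniqueness for the scalar-type fractional relaxation equation. -/
lemma eq_zero_of_hasDerivAt_rlIntegral [CompleteSpace E] (h0 : 0 < ρ) (h1 : ρ < 1) {lam T : ℝ}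
    (hl : 0 < lam) {d : ℝ → E} (hint : ∀ t ∈ Ioo 0 T, RLIntegrable (ρ - 1) d t)
    (hder : ∀ t ∈ Ioo 0 T, HasDerivAt (rlIntegral (ρ - 1) d) (-(lam • d t)) t)
    (hlim : Tendsto (rlIntegral (ρ - 1) d) (𝓝[>] 0) (𝓝 0)) : ∀ t ∈ Ioo 0 T, d t = 0 := by
  have hdi : ∀ t ∈ Ioo 0 T, IntervalIntegrable d volume 0 t := fun t ht =>
    (hint t ht).intervalIntegrable h0 ht.1
  -- The equation integrated from `0+`, where the fractional integral tends to `0`.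
  have hJ : ∀ t ∈ Ioo 0 T, rlIntegral (ρ - 1) d t = -(lam • ∫ ξ in (0 : ℝ)..t, d ξ) := by
    intro t ht
    have h2 := intervalIntegral.integral_eq_sub_of_hasDerivAt_of_tendsto ht.1
      (fun x hx => hder x ⟨hx.1, hx.2.trans ht.2⟩) ((hdi t ht).smul lam).neg hlim
      ((hder t ht).continuousAt.tendsto.mono_left nhdsWithin_le_nhds)
    rw [sub_zero] at h2
    rw [← h2, ← intervalIntegral.integral_smul, ← intervalIntegral.integral_neg]
  set B := ∫ x in (0 : ℝ)..1, (1 - x) ^ (ρ - 1) * x ^ (-ρ) with hB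
  have hBpos : 0 < B := integral_one_sub_rpow_mul_rpow_pos (by linarith) (by linarith)
  have hG : 0 < Real.Gamma (1 - ρ) := Real.Gamma_pos_of_pos (by linarith)
  -- Applying the integral of order `ρ` to `hJ` gives a Volterra equation for the primitive of `d`,
  -- which is continuous up to `0` although `d` need not be.
  have hW : ∀ t ∈ Ioo 0 T, ∫ ξ in (0 : ℝ)..t, d ξ = 0 := by
    intro t₁ ht₁
    refine eq_zero_of_volterra (W := fun t => ∫ ξ in (0 : ℝ)..t, d ξ) h0
      (c := B⁻¹ * (Real.Gamma (1 - ρ) * lam)) (by positivity) ht₁.1.le ?_ ?_ t₁ (right_mem_Icc.2 ht₁.1.le)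
    · have := intervalIntegral.continuousOn_primitive_interval' (hdi t₁ ht₁) left_mem_uIcc
      rwa [uIcc_of_le ht₁.1.le] at this
    · intro t ht
      rcases ht.1.eq_or_lt with rfl | htpos
      · simp
      have htT : t ∈ Ioo 0 T := ⟨htpos, ht.2.trans_lt ht₁.2⟩
      have h2 := integral_rpow_smul_integral_rpow_smul h0 h1 htpos (hdi t htT)
      rw [← hB] at h2
      have h3 : ∫ s in (0 : ℝ)..t, (t - s) ^ (ρ - 1) • ∫ ξ in (0 : ℝ)..s, (s - ξ) ^ (-ρ) • d ξ =
          ∫ s in (0 : ℝ)..t, (-(Real.Gamma (1 - ρ) * lam)) •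
            ((t - s) ^ (ρ - 1) • ∫ ξ in (0 : ℝ)..s, d ξ) := by
        rw [intervalIntegral.integral_of_le htpos.le, intervalIntegral.integral_of_le htpos.le]
        refine setIntegral_congr_fun measurableSet_Ioc fun s hs => ?_
        have h4 := hJ s ⟨hs.1, hs.2.trans_lt htT.2⟩
        rw [rlIntegral_sub_one, inv_smul_eq_iff₀ hG.ne'] at h4
        simp only [h4, smul_neg, smul_smul]
        rw [← neg_smul]
        congr 1
        ring
      rw [h3, intervalIntegral.integral_smul] at h2
      have h5 := congrArg norm h2
      rw [norm_smul, norm_smul, norm_neg, Real.norm_of_nonneg (by positivity),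
        Real.norm_of_nonneg hBpos.le] at h5
      rw [mul_assoc, ← div_eq_inv_mul, le_div_iff₀ hBpos, mul_comm, ← h5]
      refine mul_le_mul_of_nonneg_left ?_ (by positivity)
      refine (intervalIntegral.norm_integral_le_integral_norm htpos.le).trans (le_of_eq ?_)
      refine intervalIntegral.integral_congr fun s hs => ?_
      rw [uIcc_of_le htpos.le] at hs
      simp only [norm_smul]
      rw [Real.norm_of_nonneg (Real.rpow_nonneg (sub_nonneg.2 hs.2) _)]
  intro t ht
  -- A zero primitive alone would give `d = 0` only almost everywhere; the equation itself gives it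
  -- at every point.
  have hev : rlIntegral (ρ - 1) d =ᶠ[𝓝 t] fun _ => 0 := by
    filter_upwards [Ioo_mem_nhds ht.1 ht.2] with x hx
    rw [hJ x hx, hW x hx, smul_zero, neg_zero]
  have h2 := (hder t ht).unique ((hasDerivAt_const t (0 : E)).congr_of_eventuallyEq hev)
  exact (smul_eq_zero.1 (neg_eq_zero.1 h2)).resolve_left hl.ne'

end Volterra

/-! ### Diagonal operators and coordinates in the eigenbasis. -/

section Diagonal

variable {𝕜 H : Type*} [RCLike 𝕜] [NormedAddCommGroup H] [InnerProductSpace 𝕜 H]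

lemma hasSum_norm_inner_sq (v : HilbertBasis ℕ 𝕜 H) (x : H) :
    HasSum (fun k => ‖inner 𝕜 (v k) x‖ ^ 2) (‖x‖ ^ 2) := by
  have h := lp.hasSum_norm (p := 2) (by norm_num) (v.repr x)
  simpa [v.repr_apply_apply] using h

lemma eq_of_inner_eq (v : HilbertBasis ℕ 𝕜 H) {x y : H}
    (h : ∀ k, inner 𝕜 (v k) x = inner 𝕜 (v k) y) : x = y := by
  refine v.repr.injective (lp.ext (funext fun k => ?_))
  rw [v.repr_apply_apply, v.repr_apply_apply, h k]

/-- The diagonal operator with eigenvalues `m k` in the orthonormal basis `v`. -/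
def diag (v : HilbertBasis ℕ 𝕜 H) (m : ℕ → ℝ) (x : H) : H :=
  ∑' k, (m k • inner 𝕜 (v k) x : 𝕜) • v k

variable (v : HilbertBasis ℕ 𝕜 H) {m : ℕ → ℝ} {M : ℝ}

lemma hasSum_diag_and_inner_diag (hm : ∀ k, |m k| ≤ M) (x : H) :
    HasSum (fun k => (m k • inner 𝕜 (v k) x : 𝕜) • v k) (diag v m x) ∧
      ∀ k, inner 𝕜 (v k) (diag v m x) = m k • inner 𝕜 (v k) x := by
  have hmem : Memℓp (fun k => (m k • inner 𝕜 (v k) x : 𝕜)) 2 := by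
    refine ((lp.memℓp (v.repr x)).const_smul M).mono' fun k => ?_
    rw [Pi.smul_apply, norm_smul, norm_smul, Real.norm_eq_abs, v.repr_apply_apply]
    exact mul_le_mul_of_nonneg_right ((hm k).trans (le_abs_self M)) (norm_nonneg _)
  obtain ⟨f, hf⟩ : ∃ f : lp (fun _ : ℕ => 𝕜) 2, ∀ k, f k = m k • inner 𝕜 (v k) x :=
    ⟨⟨_, hmem⟩, fun _ => rfl⟩
  have h := v.hasSum_repr_symm f
  simp only [hf] at h
  have h2 : diag v m x = v.repr.symm f := h.tsum_eq
  refine ⟨h.summable.hasSum, fun k => ?_⟩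
  rw [← v.repr_apply_apply, h2, LinearIsometryEquiv.apply_symm_apply, hf]

lemma inner_diag (hm : ∀ k, |m k| ≤ M) (x : H) (k : ℕ) :
    inner 𝕜 (v k) (diag v m x) = m k • inner 𝕜 (v k) x :=
  (hasSum_diag_and_inner_diag v hm x).2 k

lemma norm_diag_le (hm : ∀ k, |m k| ≤ M) (x : H) : ‖diag v m x‖ ≤ M * ‖x‖ := by
  have hM : 0 ≤ M := (abs_nonneg _).trans (hm 0)
  refine le_of_sq_le_sq ?_ (by positivity)
  rw [mul_pow]
  refine hasSum_le (fun k => ?_) (hasSum_norm_inner_sq v _)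
    ((hasSum_norm_inner_sq v x).mul_left (M ^ 2))
  rw [inner_diag v hm, norm_smul, mul_pow, Real.norm_eq_abs]
  gcongr
  exact hm k

/-- A measurable family of bounded diagonal operators obeys the bound of its eigenvalues. -/
lemma powBound_diag {m : ℕ → ℝ → ℝ} {C a : ℝ} (hm : ∀ k, Measurable (m k))
    (hb : ∀ k r, 0 < r → |m k r| ≤ C * r ^ a) (x : H) :
    PowBound (fun r => diag v (fun k => m k r) x) (C * ‖x‖) a where
  aesm := by
    refine aestronglyMeasurable_of_tendsto_ae atTop
      (f := fun n r => ∑ k ∈ Finset.range n, (m k r • inner 𝕜 (v k) x : 𝕜) • v k) (fun n => ?_) ?_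
    · refine (Finset.aestronglyMeasurable_fun_sum _ fun k _ => ?_)
      exact ((hm k).aestronglyMeasurable.smul_const _).smul_const _
    · refine (ae_restrict_iff' measurableSet_Ioi).2 (.of_forall fun r hr => ?_)
      exact (hasSum_diag_and_inner_diag v (fun k => hb k r hr) x).1.tendsto_sum_nat
  le r hr := (norm_diag_le v (fun k => hb k r hr) x).trans (le_of_eq (by ring))

variable [NormedSpace ℝ H] [IsScalarTower ℝ 𝕜 H]

/-- The `k`-th coordinate, as a continuous real-linear map. -/
def coord (v : HilbertBasis ℕ 𝕜 H) (k : ℕ) : H →L[ℝ] 𝕜 := (innerSL 𝕜 (v k)).restrictScalars ℝ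

@[simp] lemma coord_apply (k : ℕ) (x : H) : coord v k x = inner 𝕜 (v k) x := rfl

lemma clm_rlIntegral {E F : Type*} [NormedAddCommGroup E] [NormedSpace ℝ E] [CompleteSpace E]
    [NormedAddCommGroup F] [NormedSpace ℝ F] [CompleteSpace F] (L : E →L[ℝ] F) {σ t : ℝ} {u : ℝ → E}
    (h : RLIntegrable σ u t) : rlIntegral σ (fun ξ => L (u ξ)) t = L (rlIntegral σ u t) := by
  rw [rlIntegral, rlIntegral, map_smul, ← L.intervalIntegral_comp_comm h]
  simp only [rlIntegrand, map_smul]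

lemma RLIntegrable.clm_comp {E F : Type*} [NormedAddCommGroup E] [NormedSpace ℝ E]
    [NormedAddCommGroup F] [NormedSpace ℝ F] (L : E →L[ℝ] F) {σ t : ℝ} {u : ℝ → E}
    (h : RLIntegrable σ u t) : RLIntegrable σ (fun ξ => L (u ξ)) t := by
  have h2 : IntervalIntegrable (fun ξ => L (rlIntegrand σ u t ξ)) volume 0 t :=
    ⟨L.integrable_comp h.1, L.integrable_comp h.2⟩
  refine h2.congr fun ξ _ => ?_
  simp only [rlIntegrand, map_smul]

lemma RLIntegrable.sub {E : Type*} [NormedAddCommGroup E] [NormedSpace ℝ E] {σ t : ℝ} {u w : ℝ → E}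
    (hw : RLIntegrable σ w t) (hu : RLIntegrable σ u t) :
    RLIntegrable σ (fun ξ => w ξ - u ξ) t := by
  refine (IntervalIntegrable.sub hw hu).congr fun ξ _ => ?_
  simp only [rlIntegrand, smul_sub]

/-- A coordinate is a continuous linear map, so it passes under the Bochner integral; this reduces
vector identities to the scalar ones. -/
lemma inner_laplace_diag [CompleteSpace H] {m : ℕ → ℝ → ℝ} {C a : ℝ} (ha : -1 < a)
    (hm : ∀ k, Measurable (m k)) (hb : ∀ k r, 0 < r → |m k r| ≤ C * r ^ a) (x : H) {t : ℝ}
    (ht : 0 < t) (k : ℕ) :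
    inner 𝕜 (v k) (laplace (fun r => diag v (fun k => m k r) x) t) =
      laplace (m k) t • inner 𝕜 (v k) x := by
  rw [← coord_apply, laplace,
    ← (coord v k).integral_comp_comm ((powBound_diag v hm hb x).integrableOn ha ht), laplace,
    ← integral_smul_const]
  refine setIntegral_congr_fun measurableSet_Ioi fun r hr => ?_
  simp only [map_smul, coord_apply, inner_diag v (fun k => hb k r hr), smul_smul, smul_eq_mul]

end Diagonal

/-! ### The operator `A` and the forward problem. -/

section Operator

variable {𝕜 H : Type*} [RCLike 𝕜] [NormedAddCommGroup H] [InnerProductSpace 𝕜 H] [CompleteSpace H]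
  {A : H →ₗ.[𝕜] H} {v : HilbertBasis ℕ 𝕜 H} {lam : ℕ → ℝ}

namespace IsPositiveDiscrete

lemma lam_ge (hA : IsPositiveDiscrete A v lam) (k : ℕ) : lam 0 ≤ lam k := hA.monotone k.zero_le

lemma lam_pos (hA : IsPositiveDiscrete A v lam) (k : ℕ) : 0 < lam k := hA.pos.trans_le (hA.lam_ge k)

lemma inner_apply (hA : IsPositiveDiscrete A v lam) (k : ℕ) (x : A.domain) :
    inner 𝕜 (v k) (A x) = lam k • inner 𝕜 (v k) (x : H) := by
  have h1 : A.adjoint = A := hA.isSelfAdjoint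
  have h2 := LinearPMap.adjoint_isFormalAdjoint hA.isSelfAdjoint.dense_domain
  rw [h1] at h2
  rw [← h2 ⟨v k, hA.mem_domain k⟩ x, hA.apply_eq k, inner_smul_left, RCLike.conj_ofReal,
    RCLike.real_smul_eq_coe_mul]

/-- A self-adjoint operator is closed: the partial sums of the expansions of `x` and `y` form pairs
in its graph, and these converge to `(x, y)`. -/
lemma exists_apply_eq (hA : IsPositiveDiscrete A v lam) {x y : H}
    (h : ∀ k, inner 𝕜 (v k) y = lam k • inner 𝕜 (v k) x) :
    ∃ hx : x ∈ A.domain, A ⟨x, hx⟩ = y := by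
  have hcl : IsClosed (A.graph : Set (H × H)) := hA.isSelfAdjoint.isClosed
  have hgraph : (x, y) ∈ A.graph := by
    have hx := (v.hasSum_repr x).tendsto_sum_nat
    have hy := (v.hasSum_repr y).tendsto_sum_nat
    refine hcl.mem_of_tendsto (hx.prodMk_nhds hy) (.of_forall fun n => ?_)
    have hsum : (∑ k ∈ Finset.range n, v.repr x k • v k, ∑ k ∈ Finset.range n, v.repr y k • v k) =
        ∑ k ∈ Finset.range n, v.repr x k • (v k, (lam k : 𝕜) • v k) := by
      rw [Prod.ext_iff, Prod.fst_sum, Prod.snd_sum]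
      refine ⟨rfl, ?_⟩
      change ∑ k ∈ Finset.range n, v.repr y k • v k = _
      refine Finset.sum_congr rfl fun k _ => ?_
      rw [v.repr_apply_apply, v.repr_apply_apply, h k, Prod.smul_snd, smul_smul,
        RCLike.real_smul_eq_coe_mul, mul_comm]
    rw [SetLike.mem_coe, hsum]
    refine Submodule.sum_mem _ fun k _ => Submodule.smul_mem _ _ ?_
    rw [← hA.apply_eq k]
    exact A.mem_graph ⟨v k, hA.mem_domain k⟩
  obtain ⟨z, hz1, hz2⟩ := (LinearPMap.mem_graph_iff A).1 hgraph
  simp only at hz1 hz2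
  subst hz1
  exact ⟨z.2, hz2⟩

end IsPositiveDiscrete

/-- The solution of the homogeneous forward problem, as a Laplace transform. -/
def homogeneousSolution [NormedSpace ℝ H] (v : HilbertBasis ℕ 𝕜 H) (lam : ℕ → ℝ) (ρ : ℝ)
    (φ : H) : ℝ → H :=
  laplace fun r => diag v (fun k => mlDensity ρ (lam k) r) φ

variable {ρ : ℝ}

namespace IsPositiveDiscrete

variable (hA : IsPositiveDiscrete A v lam) (h0 : 0 < ρ) (h1 : ρ < 1)
include hA h0 h1

lemma abs_mlDensity_le (k : ℕ) (r : ℝ) (hr : 0 < r) :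
    |mlDensity ρ (lam k) r| ≤ mlConst ρ * r ^ (-ρ) :=
  (powBound_mlDensity h0 h1 (hA.lam_pos k)).le r hr

lemma abs_mul_mlDensity_le (k : ℕ) (r : ℝ) (hr : 0 < r) :
    |lam k * mlDensity ρ (lam k) r| ≤ mlConst ρ * r ^ (0 : ℝ) := by
  rw [abs_of_nonneg (mul_nonneg (hA.lam_pos k).le (mlDensity_nonneg h0 h1 (hA.lam_pos k) hr)),
    Real.rpow_zero, mul_one]
  exact mul_mlDensity_le h0 h1 (hA.lam_pos k) hr

lemma abs_mul_mlDensity_div_le (k : ℕ) (r : ℝ) (hr : 0 < r) :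
    |lam k * mlDensity ρ (lam k) r / r| ≤ mlConst ρ / lam 0 * r ^ (ρ - 1) := by
  rw [abs_of_nonneg (div_nonneg
    (mul_nonneg (hA.lam_pos k).le (mlDensity_nonneg h0 h1 (hA.lam_pos k) hr)) hr.le)]
  exact mul_mlDensity_div_le h0 h1 hA.pos (hA.lam_ge k) hr

lemma powBound_density (φ : H) :
    PowBound (fun r => diag v (fun k => mlDensity ρ (lam k) r) φ) (mlConst ρ * ‖φ‖) (-ρ) :=
  powBound_diag v (fun _ => measurable_mlDensity) (hA.abs_mlDensity_le h0 h1) φ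

lemma powBound_apply_density (φ : H) :
    PowBound (fun r => diag v (fun k => lam k * mlDensity ρ (lam k) r) φ) (mlConst ρ * ‖φ‖) 0 :=
  powBound_diag v (fun k => measurable_mlDensity.const_mul (lam k))
    (hA.abs_mul_mlDensity_le h0 h1) φ

lemma powBound_apply_density_div (φ : H) :
    PowBound (fun r => diag v (fun k => lam k * mlDensity ρ (lam k) r / r) φ)
      (mlConst ρ / lam 0 * ‖φ‖) (ρ - 1) :=
  powBound_diag v (fun k => (measurable_mlDensity.const_mul (lam k)).div measurable_id)
    (hA.abs_mul_mlDensity_div_le h0 h1) φ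

variable [NormedSpace ℝ H]

lemma norm_homogeneousSolution_le_rpow (φ : H) {t : ℝ} (ht : 0 < t) :
    ‖homogeneousSolution v lam ρ φ t‖ ≤
      mlConst ρ * ‖φ‖ * Real.Gamma (1 - ρ) * t ^ (ρ - 1) := by
  have h := (hA.powBound_density h0 h1 φ).norm_laplace_le (by linarith) ht
  rwa [neg_add_eq_sub, neg_sub] at h

lemma norm_homogeneousSolution_le (φ : H) {t : ℝ} (ht : 0 < t) :
    ‖homogeneousSolution v lam ρ φ t‖ ≤
      mlConst ρ * (Real.Gamma (ρ + 1) + Real.Gamma (1 - ρ)) * t ^ (ρ - 1) /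
        (1 + (lam 0 * t ^ ρ) ^ 2) * ‖φ‖ := by
  set l := lam 0
  have hl : 0 < l := hA.pos
  have hc := mlConst_pos h0 h1
  have hτ : 0 < t ^ ρ := Real.rpow_pos_of_pos ht ρ
  set D := 1 + (l * t ^ ρ) ^ 2 with hD
  have hDpos : 0 < D := by positivity
  have hpt : ∀ r : ℝ, 0 < r → ‖diag v (fun k => mlDensity ρ (lam k) r) φ‖ ≤
      mlConst ρ * ‖φ‖ / D * ((t ^ ρ) ^ 2 * r ^ ρ + r ^ (-ρ)) := by
    intro r hr
    have hy : 0 < r ^ ρ := Real.rpow_pos_of_pos hr ρ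
    have h2 : ∀ k, |mlDensity ρ (lam k) r| ≤ mlConst ρ * (r ^ ρ / ((r ^ ρ) ^ 2 + l ^ 2)) := by
      intro k
      rw [abs_of_nonneg (mlDensity_nonneg h0 h1 (hA.lam_pos k) hr)]
      refine (mlDensity_le h0 h1 (hA.lam_pos k) hr).trans ?_
      have := hA.lam_ge k
      gcongr
    -- Multiplied out, the left side is two of the four nonnegative terms on the right. Both powers
    -- of `r` integrate against `e ^ (-rt)` to multiples of `t ^ (ρ - 1)`, with the factors `Γ(ρ +
    -- 1)` and `Γ(1 - ρ)`.
    have h3 : r ^ ρ / ((r ^ ρ) ^ 2 + l ^ 2) ≤ ((t ^ ρ) ^ 2 * r ^ ρ + r ^ (-ρ)) / D := by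
      rw [Real.rpow_neg hr.le, div_le_div_iff₀ (by positivity) hDpos, hD]
      have h4 : ((t ^ ρ) ^ 2 * r ^ ρ + (r ^ ρ)⁻¹) * ((r ^ ρ) ^ 2 + l ^ 2) =
          (t ^ ρ) ^ 2 * (r ^ ρ) ^ 3 + (l * t ^ ρ) ^ 2 * r ^ ρ + r ^ ρ + l ^ 2 * (r ^ ρ)⁻¹ := by
        field_simp
        ring
      rw [h4]
      have h5 : 0 ≤ (t ^ ρ) ^ 2 * (r ^ ρ) ^ 3 := by positivity
      have h6 : 0 ≤ l ^ 2 * (r ^ ρ)⁻¹ := by positivity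
      linarith
    refine (norm_diag_le v h2 φ).trans ?_
    have h7 := mul_le_mul_of_nonneg_left h3 (by positivity : 0 ≤ mlConst ρ * ‖φ‖)
    calc _ = mlConst ρ * ‖φ‖ * (r ^ ρ / ((r ^ ρ) ^ 2 + l ^ 2)) := by ring
      _ ≤ _ := h7
      _ = _ := by ring
  have i1 := integrableOn_exp_mul_rpow (a := ρ) (by linarith) ht
  have i2 := integrableOn_exp_mul_rpow (a := -ρ) (by linarith) ht
  refine (norm_integral_le_of_norm_le (((i1.const_mul ((t ^ ρ) ^ 2)).add i2).const_mul
    (mlConst ρ * ‖φ‖ / D))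
    ((ae_restrict_iff' measurableSet_Ioi).2 (.of_forall fun r (hr : 0 < r) => ?_))).trans
    (le_of_eq ?_)
  · rw [norm_smul, Real.norm_of_nonneg (Real.exp_pos _).le, Pi.add_apply]
    have h8 := mul_le_mul_of_nonneg_left (hpt r hr) (Real.exp_pos (-(r * t))).le
    refine h8.trans (le_of_eq (by ring))
  · have h9 : t ^ (-(ρ + 1)) * (t ^ ρ) ^ 2 = t ^ (ρ - 1) := by
      rw [← Real.rpow_natCast, ← Real.rpow_mul ht.le, ← Real.rpow_add ht]
      congr 1
      push_cast
      ring
    have h10 : -(-ρ + 1) = ρ - 1 := by ring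
    simp only [Pi.add_apply]
    rw [integral_const_mul, integral_add (i1.const_mul _) i2, integral_const_mul,
      integral_exp_mul_rpow (by linarith) ht, integral_exp_mul_rpow (by linarith) ht, h10,
      neg_add_eq_sub]
    linear_combination (mlConst ρ * ‖φ‖ / D * Real.Gamma (ρ + 1)) * h9

lemma norm_iteratedDeriv_homogeneousSolution_le (φ : H) (m : ℕ) {t : ℝ} (ht : 0 < t) :
    ‖iteratedDeriv m (homogeneousSolution v lam ρ φ) t‖ ≤
      mlConst ρ * Real.Gamma (-ρ + m + 1) * t ^ (ρ - 1 - (m : ℝ)) * ‖φ‖ := by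
  have h := (hA.powBound_density h0 h1 φ).norm_iteratedDeriv_laplace_le (by linarith) m ht
  rw [show -(-ρ + m + 1) = ρ - 1 - (m : ℝ) by ring] at h
  exact h.trans (le_of_eq (by ring))

lemma rlIntegrable_homogeneousSolution (φ : H) {t : ℝ} (ht : 0 < t) :
    RLIntegrable (ρ - 1) (homogeneousSolution v lam ρ φ) t :=
  rlIntegrable_of_norm_le h1 h0
    ((hA.powBound_density h0 h1 φ).continuousOn_laplace (by linarith))
    (fun _ ht => hA.norm_homogeneousSolution_le_rpow h0 h1 φ ht) ht

variable [IsScalarTower ℝ 𝕜 H]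

lemma inner_homogeneousSolution (φ : H) {t : ℝ} (ht : 0 < t) (k : ℕ) :
    inner 𝕜 (v k) (homogeneousSolution v lam ρ φ t) =
      laplace (mlDensity ρ (lam k)) t • inner 𝕜 (v k) φ :=
  inner_laplace_diag v (by linarith) (fun _ => measurable_mlDensity)
    (hA.abs_mlDensity_le h0 h1) φ ht k

lemma inner_laplace_apply_density_div (φ : H) {t : ℝ} (ht : 0 < t) (k : ℕ) :
    inner 𝕜 (v k) (laplace (fun r => diag v (fun k => lam k * mlDensity ρ (lam k) r / r) φ) t) =
      laplace (fun r => lam k * mlDensity ρ (lam k) r / r) t • inner 𝕜 (v k) φ :=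
  inner_laplace_diag v (m := fun k r => lam k * mlDensity ρ (lam k) r / r) (by linarith)
    (fun k => (measurable_mlDensity.const_mul (lam k)).div measurable_id)
    (hA.abs_mul_mlDensity_div_le h0 h1) φ ht k

lemma exists_apply_homogeneousSolution (φ : H) {t : ℝ} (ht : 0 < t) :
    ∃ hx : homogeneousSolution v lam ρ φ t ∈ A.domain,
      A ⟨homogeneousSolution v lam ρ φ t, hx⟩ =
        laplace (fun r => diag v (fun k => lam k * mlDensity ρ (lam k) r) φ) t := by
  refine hA.exists_apply_eq fun k => ?_
  rw [hA.inner_homogeneousSolution h0 h1 φ ht,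
    inner_laplace_diag v (m := fun k r => lam k * mlDensity ρ (lam k) r) (a := 0) (by norm_num)
      (fun k => measurable_mlDensity.const_mul (lam k)) (hA.abs_mul_mlDensity_le h0 h1) φ ht,
    smul_smul]
  congr 1
  simp only [laplace, smul_eq_mul]
  rw [← integral_const_mul]
  simp only [mul_left_comm]

lemma rlIntegral_homogeneousSolution (φ : H) :
    EqOn (rlIntegral (ρ - 1) (homogeneousSolution v lam ρ φ))
      (laplace fun r => diag v (fun k => lam k * mlDensity ρ (lam k) r / r) φ) (Ioi 0) := by
  intro t (ht : 0 < t)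
  refine eq_of_inner_eq v fun k => ?_
  rw [hA.inner_laplace_apply_density_div h0 h1 φ ht,
    ← rlIntegral_laplace_mlDensity h0 h1 (hA.lam_pos k) ht, ← coord_apply,
    ← clm_rlIntegral (coord v k) (hA.rlIntegrable_homogeneousSolution h0 h1 φ ht),
    rlIntegral_sub_one, rlIntegral_sub_one, smul_assoc, ← intervalIntegral.integral_smul_const,
    intervalIntegral.integral_of_le ht.le, intervalIntegral.integral_of_le ht.le]
  congr 1
  refine setIntegral_congr_fun measurableSet_Ioc fun ξ hξ => ?_
  simp only [coord_apply, smul_assoc]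
  rw [hA.inner_homogeneousSolution h0 h1 φ hξ.1]

/-- Differentiation brings down `-r`, which cancels the division by `r`; what remains is `-A u(t)`
for the solution `u`. -/
lemma hasDerivAt_laplace_apply_density_div (φ : H) {t : ℝ} (ht : 0 < t) :
    HasDerivAt (laplace fun r => diag v (fun k => lam k * mlDensity ρ (lam k) r / r) φ)
      (-laplace (fun r => diag v (fun k => lam k * mlDensity ρ (lam k) r) φ) t) t := by
  refine ((hA.powBound_apply_density_div h0 h1 φ).hasDerivAt_laplace (by linarith) ht).congr_deriv ?_
  rw [laplace, laplace, ← integral_neg]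
  refine setIntegral_congr_fun measurableSet_Ioi fun r (hr : 0 < r) => ?_
  simp only [neg_smul, smul_neg]
  congr 2
  refine eq_of_inner_eq v fun k => ?_
  rw [← coord_apply, map_smul, coord_apply,
    inner_diag v (fun k => hA.abs_mul_mlDensity_div_le h0 h1 k r hr),
    inner_diag v (fun k => hA.abs_mul_mlDensity_le h0 h1 k r hr), smul_smul,
    mul_div_cancel₀ _ hr.ne']

/-- By Parseval the squared distance to `φ` is `∑ (P k t - 1) ^ 2 ‖φ_k‖ ^ 2`, where `φ_k` are the
coordinates of `φ`. Each `P k t` lies in `[0, 1]` and tends to `1`, so dominated convergence for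
series applies. -/
lemma tendsto_laplace_apply_density_div (φ : H) :
    Tendsto (laplace fun r => diag v (fun k => lam k * mlDensity ρ (lam k) r / r) φ)
      (𝓝[>] 0) (𝓝 φ) := by
  set p := laplace fun r => diag v (fun k => lam k * mlDensity ρ (lam k) r / r) φ
  let P : ℕ → ℝ → ℝ := fun k => laplace fun r => lam k * mlDensity ρ (lam k) r / r
  have hP : ∀ k t, 0 < t → P k t ∈ Icc (0 : ℝ) 1 := fun k t ht =>
    laplace_mul_mlDensity_div_mem h0 h1 (hA.lam_pos k) ht
  have hlim : Tendsto (fun t => ∑' k, ‖(P k t - 1) • inner 𝕜 (v k) φ‖ ^ 2) (𝓝[>] 0)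
      (𝓝 (∑' _ : ℕ, (0 : ℝ))) := by
    refine tendsto_tsum_of_dominated_convergence (hasSum_norm_inner_sq v φ).summable
      (fun k => ?_) ?_
    · have h2 := (tendsto_laplace_mul_mlDensity_div h0 h1 (hA.lam_pos k)).sub_const 1
      have h3 := ((h2.smul_const (inner 𝕜 (v k) φ)).norm).pow 2
      simpa using h3
    · filter_upwards [self_mem_nhdsWithin] with t ht k
      rw [Real.norm_of_nonneg (by positivity), norm_smul, mul_pow]
      refine mul_le_of_le_one_left (by positivity) ?_
      have := hP k t ht
      rw [Real.norm_eq_abs, sq_abs]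
      nlinarith [this.1, this.2]
  rw [tsum_zero] at hlim
  rw [tendsto_iff_norm_sub_tendsto_zero]
  have hsq : Tendsto (fun t => ‖p t - φ‖ ^ 2) (𝓝[>] 0) (𝓝 0) := by
    refine hlim.congr' ?_
    filter_upwards [self_mem_nhdsWithin] with t ht
    rw [← (hasSum_norm_inner_sq v (p t - φ)).tsum_eq]
    refine tsum_congr fun k => ?_
    rw [inner_sub_right, hA.inner_laplace_apply_density_div h0 h1 φ ht, sub_smul, one_smul]
  have := hsq.sqrt
  simpa [Real.sqrt_sq] using this

/-- Existence for the homogeneous forward problem. -/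
lemma isForwardSolution_homogeneousSolution (φ : H) (T : ℝ) :
    IsForwardSolution A ρ T (fun _ => 0) φ (homogeneousSolution v lam ρ φ) := by
  have hrl := hA.rlIntegral_homogeneousSolution h0 h1 φ
  have hder : ∀ t, 0 < t → HasDerivAt (rlIntegral (ρ - 1) (homogeneousSolution v lam ρ φ))
      (-laplace (fun r => diag v (fun k => lam k * mlDensity ρ (lam k) r) φ) t) t := fun t ht =>
    (hA.hasDerivAt_laplace_apply_density_div h0 h1 φ ht).congr_of_eventuallyEq
      (hrl.eventuallyEq_of_mem (Ioi_mem_nhds ht))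
  have hcont : ContinuousOn
      (laplace fun r => diag v (fun k => lam k * mlDensity ρ (lam k) r) φ) (Ioi 0) :=
    (hA.powBound_apply_density h0 h1 φ).continuousOn_laplace (by norm_num)
  have hsub : Ioo 0 T ⊆ Ioi 0 := fun _ ht => ht.1
  refine ⟨?_, ?_, ?_, ?_, ?_, ?_, ?_, ?_⟩
  · exact ((hA.powBound_density h0 h1 φ).continuousOn_laplace (by linarith)).mono fun _ ht => ht.1
  · exact fun t ht => hA.rlIntegrable_homogeneousSolution h0 h1 φ ht.1
  · exact fun t ht => (hder t ht.1).differentiableAt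
  · exact (hcont.mono hsub).neg.congr fun t ht => (hder t ht.1).deriv
  · exact fun t => (hA.exists_apply_homogeneousSolution h0 h1 φ t.2.1).1
  · refine (continuousOn_iff_continuous_domRestrict.1 (hcont.mono hsub)).congr fun t => ?_
    exact (hA.exists_apply_homogeneousSolution h0 h1 φ t.2.1).2.symm
  · intro t
    rw [(hA.exists_apply_homogeneousSolution h0 h1 φ t.2.1).2, rlDeriv, (hder t t.2.1).deriv,
      neg_add_cancel]
  · exact (hA.tendsto_laplace_apply_density_div h0 h1 φ).congr'
      (hrl.symm.eventuallyEq_of_mem self_mem_nhdsWithin)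

/-- Uniqueness for the forward problem. -/
lemma eqOn_of_isForwardSolution {T : ℝ} (hT : 0 < T) {f : ℝ → H} {φ : H} {u w : ℝ → H}
    (hu : IsForwardSolution A ρ T f φ u) (hw : IsForwardSolution A ρ T f φ w) :
    EqOn w u (Ioc 0 T) := by
  have hIoo : EqOn w u (Ioo 0 T) := by
    intro t ht
    refine eq_of_inner_eq v fun k => sub_eq_zero.1 ?_
    have hder {u : ℝ → H} (hu : IsForwardSolution A ρ T f φ u) (t : Ioo 0 T) :
        HasDerivAt (rlIntegral (ρ - 1) u) (f t - A ⟨u t, hu.mem_domain t⟩) t := by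
      rw [← hu.equation t, add_sub_cancel_right]
      exact (hu.differentiableAt t t.2).hasDerivAt
    have hsub : ∀ t ∈ Ioo 0 T, RLIntegrable (ρ - 1) (fun ξ => w ξ - u ξ) t := fun t ht =>
      (hw.rlIntegrable t ht).sub (hu.rlIntegrable t ht)
    have hint : ∀ t ∈ Ioo 0 T, RLIntegrable (ρ - 1) (fun ξ => coord v k (w ξ - u ξ)) t :=
      fun t ht => (hsub t ht).clm_comp (coord v k)
    have hrl : ∀ t ∈ Ioo 0 T, rlIntegral (ρ - 1) (fun ξ => coord v k (w ξ - u ξ)) t =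
        coord v k (rlIntegral (ρ - 1) w t - rlIntegral (ρ - 1) u t) := by
      intro t ht
      rw [clm_rlIntegral (coord v k) (hsub t ht)]
      congr 1
      simp only [rlIntegral, ← smul_sub]
      rw [← intervalIntegral.integral_sub (hw.rlIntegrable t ht) (hu.rlIntegrable t ht)]
      simp only [rlIntegrand, smul_sub]
    -- In the `k`-th coordinate `A` acts as multiplication by `lam k`, so the difference solves the
    -- homogeneous scalar equation with zero initial value.
    have key := eq_zero_of_hasDerivAt_rlIntegral h0 h1 (hA.lam_pos k) hint ?_ ?_ t ht
    · simpa [inner_sub_right] using key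
    · intro t ht
      have h2 := (coord v k).hasFDerivAt.comp_hasDerivAt t
        ((hder hw ⟨t, ht⟩).sub (hder hu ⟨t, ht⟩))
      refine (h2.congr_of_eventuallyEq ?_).congr_deriv ?_
      · filter_upwards [Ioo_mem_nhds ht.1 ht.2] with x hx
        exact hrl x hx
      · rw [sub_sub_sub_cancel_left, coord_apply, coord_apply, inner_sub_right, inner_sub_right,
          hA.inner_apply, hA.inner_apply, ← smul_sub, ← smul_neg, neg_sub]
    · have h2 := ((coord v k).continuous.tendsto _).comp (hw.initial.sub hu.initial)
      rw [sub_self, map_zero] at h2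
      refine h2.congr' ?_
      filter_upwards [Ioo_mem_nhdsGT hT] with x hx
      exact (hrl x hx).symm
  -- The equation holds only on the open interval; the endpoint `T` is reached by continuity.
  refine hIoo.of_subset_closure hw.continuousOn hu.continuousOn Ioo_subset_Ioc_self ?_
  rw [closure_Ioo hT.ne]
  exact Ioc_subset_Icc_self

end IsPositiveDiscrete

end Operator

end Subdiffusion

end

theorem theorem4 (ρ : ℝ) (hρ0 : 0 < ρ) (hρ1 : ρ < 1) :
    ∃ (C : ℝ) (C' : ℕ → ℝ),
      ∀ (𝕜 : Type*) [RCLike 𝕜] (H : Type*) [NormedAddCommGroup H] [InnerProductSpace 𝕜 H]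
        [CompleteSpace H] [NormedSpace ℝ H] [IsScalarTower ℝ 𝕜 H]
        (A : H →ₗ.[𝕜] H) (v : HilbertBasis ℕ 𝕜 H) (lam : ℕ → ℝ),
        Subdiffusion.IsPositiveDiscrete A v lam →
        ∀ φ : H, ∃ u : ℝ → H,
          (∀ T : ℝ, 0 < T → Subdiffusion.IsForwardSolution A ρ T (fun _ => 0) φ u) ∧
          (∀ T : ℝ, 0 < T → ∀ w : ℝ → H,
            Subdiffusion.IsForwardSolution A ρ T (fun _ => 0) φ w → EqOn w u (Ioc 0 T)) ∧
          ContDiffOn ℝ ∞ u (Ioi 0) ∧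
          (∀ t : ℝ, 0 < t →
            ‖u t‖ ≤ C * t ^ (ρ - 1) / (1 + (lam 0 * t ^ ρ) ^ 2) * ‖φ‖) ∧
          (∀ m : ℕ, ∀ t : ℝ, 0 < t →
            ‖iteratedDeriv m u t‖ ≤ C' m * t ^ (ρ - 1 - (m : ℝ)) * ‖φ‖) := by
  refine ⟨Subdiffusion.mlConst ρ * (Real.Gamma (ρ + 1) + Real.Gamma (1 - ρ)),
    fun m => Subdiffusion.mlConst ρ * Real.Gamma (-ρ + m + 1), ?_⟩
  intro 𝕜 _ H _ _ _ _ _ A v lam hA φ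
  have hsol := hA.isForwardSolution_homogeneousSolution hρ0 hρ1 φ
  exact ⟨Subdiffusion.homogeneousSolution v lam ρ φ, fun T _ => hsol T,
    fun T hT w hw => hA.eqOn_of_isForwardSolution hρ0 hρ1 hT (hsol T) hw,
    (hA.powBound_density hρ0 hρ1 φ).contDiffOn_laplace (by linarith),
    fun t ht => hA.norm_homogeneousSolution_le hρ0 hρ1 φ ht,
    fun m t ht => hA.norm_iteratedDeriv_homogeneousSolution_le hρ0 hρ1 φ m ht⟩
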